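/- Let $k$ be a field and let $\mathfrak g$ be a (right) Leibniz algebra over $k$: a $k$-vector space with a bilinear product satisfying $x(yz)=(xy)z-(xz)y$. Let $\mathfrak g_{\mathrm{Lie}}=\mathfrak g/\langle x^2\mid x\in\mathfrak g\rangle_k$ be the associated Lie algebra, with $\bar x$ the class of $x$. A $\mathfrak g$-module is a $k$-vector space $M$ with bilinear left and right actions of $\mathfrak g$ such that $$m(xy)=(mx)y-(my)x,\qquad x(my)=(xm)y-(xy)m,\qquad x(ym)=(xy)m-(xm)y ;$$ $\mathrm{Ext}^*_{\mathfrak g}$ denotes $\mathrm{Ext}$ in the abelian category of $\mathfrak g$-modules. For a right $\mathfrak g_{\mathrm{Lie}}$-module $N$, the $\mathfrak g$-modules $N^{\mathrm s}$ and $N^{\mathrm a}$ have underlying space $N$ and right action $nx=n\bar x$; the left action is $xn=-n\bar x$ on $N^{\mathrm s}$ and $xn=0$ on $N^{\mathrm a}$. Let $\mathfrak g^\downarrow$ be $\mathfrak g$ as a right $\mathfrak g_{\mathrm{Lie}}$-module, $y\bar x=yx$. Right $\mathfrak g_{\mathrm{Lie}}$-modules $N\otimes P$ and $\mathrm{Hom}_k(P,N)$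 carry the diagonal actions $(n\otimes p)h=nh\otimes p+n\otimes ph$ and $(fh)(p)=f(p)h-f(ph)$; $N^\sharp=\mathrm{Hom}_k(N,k)$, with $(fh)(n)=-f(nh)$. Here $k$ also denotes the trivial module. Lie algebra cohomology is $H^*(\mathfrak g_{\mathrm{Lie}};N)=\mathrm{Ext}^*(k,N)$ in the category of right $\mathfrak g_{\mathrm{Lie}}$-modules. All $\mathrm{Ext}^n$ and $H^n$ with $n<0$ are zero. For every integer $n$ there are isomorphisms of $k$-vector spaces, natural in the right $\mathfrak g_{\mathrm{Lie}}$-module $N$: $$\begin{aligned} \mathrm{Ext}^n_{\mathfrak g}(k,N^{\mathrm s})&\cong H^n(\mathfrak g_{\mathrm{Lie}};N)\oplus \mathrm{Ext}^{n-1}_{\mathfrak g}((\mathfrak g^\downarrow)^{\mathrm a},N^{\mathrm s}),\\ \mathrm{Ext}^n_{\mathfrak g}(N^{\mathrm s},k)&\cong H^n(\mathfrak g_{\mathrm{Lie}};N^\sharp)\oplus \mathrm{Ext}^{n-1}_{\mathfrak g}((N\otimes\mathfrak g^\downarrow)^{\mathrm a},k),\\ \mathrm{Ext}^n_{\mathfrak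 g}(k,N^{\mathrm a})&\cong H^n(\mathfrak g_{\mathrm{Lie}};N)\oplus \mathrm{Ext}^{n-1}_{\mathfrak g}(k,\mathrm{Hom}_k(\mathfrak g^\downarrow,N)^{\mathrm s}),\\ \mathrm{Ext}^n_{\mathfrak g}(N^{\mathrm a},k)&\cong H^n(\mathfrak g_{\mathrm{Lie}};N^\sharp)\oplus \mathrm{Ext}^{n-1}_{\mathfrak g}(N^{\mathrm a},((\mathfrak g^\downarrow)^\sharp)^{\mathrm s}). \end{aligned}$$ Hence there are also natural isomorphisms $$\begin{aligned} \mathrm{Ext}^n_{\mathfrak g}(N^{\mathrm s},k)&\cong H^n(\mathfrak g_{\mathrm{Lie}};N^\sharp)\oplus H^{n-1}(\mathfrak g_{\mathrm{Lie}};(N\otimes\mathfrak g^\downarrow)^\sharp)\oplus \mathrm{Ext}^{n-2}_{\mathfrak g}((N\otimes\mathfrak g^\downarrow)^{\mathrm a},((\mathfrak g^\downarrow)^\sharp)^{\mathrm s}),\\ \mathrm{Ext}^n_{\mathfrak g}(k,N^{\mathrm a})&\cong H^n(\mathfrak g_{\mathrm{Lie}};N)\oplus H^{n-1}(\mathfrak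 g_{\mathrm{Lie}};\mathrm{Hom}_k(\mathfrak g^\downarrow,N))\oplus \mathrm{Ext}^{n-2}_{\mathfrak g}((\mathfrak g^\downarrow)^{\mathrm a},\mathrm{Hom}_k(\mathfrak g^\downarrow,N)^{\mathrm s}). \end{aligned}$$ -/

import Mathlib

open CategoryTheory Limits TensorProduct

universe u

/-! ### Leibniz algebras -/

/-- The (right) Leibniz relation `x(yz) = (xy)z - (xz)y`.  A Leibniz algebra over `k` is a
`k`-vector space `g` with a `k`-bilinear product (a non-unital non-associative `k`-algebra in
Mathlib's sense) satisfying this relation. -/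
class IsRightLeibniz (g : Type u) [NonUnitalNonAssocRing g] : Prop where
  leibniz : ∀ x y z : g, x * (y * z) = (x * y) * z - (x * z) * y

section LeibnizAlgebra

variable (k : Type u) [Field k] (g : Type u) [NonUnitalNonAssocRing g] [Module k g]

/-- The subspace spanned by the squares. -/
def squareSpan : Submodule k g := Submodule.span k (Set.range fun x : g => x * x)

/-- The Lie algebra `g_Lie = g / ⟨x²⟩` associated with a Leibniz algebra `g`. -/
def LieQuot : Type u := g ⧸ squareSpan k g

namespace LieQuot

noncomputable instance : AddCommGroup (LieQuot k g) :=
  inferInstanceAs (AddCommGroup (g ⧸ squareSpan k g))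

noncomputable instance : Module k (LieQuot k g) :=
  inferInstanceAs (Module k (g ⧸ squareSpan k g))

/-- The canonical surjection `x ↦ x̄` from `g` to `g_Lie`. -/
noncomputable def mk : g →ₗ[k] LieQuot k g := (squareSpan k g).mkQ

theorem mk_surjective : Function.Surjective (mk k g) := (squareSpan k g).mkQ_surjective

variable {k g}

theorem mk_eq_zero {x : g} : mk k g x = 0 ↔ x ∈ squareSpan k g :=
  Submodule.Quotient.mk_eq_zero _

theorem mk_mul_self (x : g) : mk k g (x * x) = 0 :=
  mk_eq_zero.2 (Submodule.subset_span ⟨x, rfl⟩)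

/-- Linear maps out of `g` that vanish on squares descend to `g_Lie`. -/
noncomputable def lift {V : Type u} [AddCommGroup V] [Module k V] (f : g →ₗ[k] V)
    (hf : ∀ x, f (x * x) = 0) : LieQuot k g →ₗ[k] V :=
  (squareSpan k g).liftQ f (by
    rw [squareSpan, Submodule.span_le]
    rintro _ ⟨x, rfl⟩
    exact hf x)

@[simp] theorem lift_mk {V : Type u} [AddCommGroup V] [Module k V] (f : g →ₗ[k] V)
    (hf : ∀ x, f (x * x) = 0) (x : g) : lift f hf (mk k g x) = f x := rfl

variable [IsRightLeibniz g]

theorem mul_sq (x y : g) : x * (y * y) = 0 := by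
  rw [IsRightLeibniz.leibniz, sub_self]

theorem mk_sq_mul (x y : g) : mk k g ((x * x) * y) = 0 := by
  have h1 := IsRightLeibniz.leibniz x x y
  have h : (x * x) * y = (x + x * y) * (x + x * y) - x * x - (x * y) * (x * y) := by
    rw [mul_add, add_mul, add_mul, h1]; abel
  rw [h, map_sub, map_sub, mk_mul_self, mk_mul_self, mk_mul_self]; simp

variable [IsScalarTower k g g] [SMulCommClass k g g]

variable (k g) in
/-- The product induced on `g_Lie`, as a bilinear map. -/
noncomputable def bracket : LieQuot k g →ₗ[k] LieQuot k g →ₗ[k] LieQuot k g :=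
  lift (lift (((LinearMap.mul k g).compr₂ (mk k g)).flip) (fun y => by
      ext x; simp [mul_sq])).flip
    (fun x => by
      ext z
      obtain ⟨y, rfl⟩ := mk_surjective k g z
      simp [mk_sq_mul])

noncomputable instance : Bracket (LieQuot k g) (LieQuot k g) := ⟨fun x y => bracket k g x y⟩

theorem mk_bracket (x y : g) : ⁅mk k g x, mk k g y⁆ = mk k g (x * y) := rfl

noncomputable instance : LieRing (LieQuot k g) where
  add_lie x y z := by change bracket k g _ _ = bracket k g _ _ + bracket k g _ _; simp
  lie_add x y z := by change bracket k g _ _ = bracket k g _ _ + bracket k g _ _; simp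
  lie_self x := by
    obtain ⟨x, rfl⟩ := mk_surjective k g x
    rw [mk_bracket, mk_mul_self]
  leibniz_lie x y z := by
    obtain ⟨x, rfl⟩ := mk_surjective k g x
    obtain ⟨y, rfl⟩ := mk_surjective k g y
    obtain ⟨z, rfl⟩ := mk_surjective k g z
    have h : mk k g (y * (x * z)) = - mk k g ((x * z) * y) := by
      have h2 := mk_mul_self (k := k) (y + x * z)
      rw [mul_add, add_mul, add_mul] at h2
      simp only [map_add, mk_mul_self, zero_add, add_zero] at h2
      rw [eq_neg_iff_add_eq_zero, add_comm]; exact h2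
    simp only [mk_bracket]
    rw [h, IsRightLeibniz.leibniz x y z, map_sub]; abel

noncomputable instance : LieAlgebra k (LieQuot k g) where
  lie_smul t x y := by change bracket k g _ _ = t • bracket k g _ _; simp

end LieQuot

end LeibnizAlgebra

/-! ### Algebras presented by generators and relations, acting on a vector space -/

namespace Presented

variable {k : Type u} [Field k] {V : Type u} [AddCommGroup V] [Module k V]
  (r : TensorAlgebra k V → TensorAlgebra k V → Prop)

/-- The class of a generator. -/
noncomputable def gen : V →ₗ[k] RingQuot r :=
  (RingQuot.mkAlgHom k r).toLinearMap ∘ₗ TensorAlgebra.ι k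

theorem hom_ext {B : Type u} [Ring B] [Algebra k B] {φ ψ : RingQuot r →ₐ[k] B}
    (h : ∀ v, φ (gen r v) = ψ (gen r v)) : φ = ψ := by
  apply RingQuot.ringQuot_ext'
  apply TensorAlgebra.hom_ext
  ext v
  exact h v

variable {r}

/-- Extension of a linear family of operators to an action of the presented algebra. -/
noncomputable def act {M : Type u} [AddCommGroup M] [Module k M] (f : V →ₗ[k] Module.End k M)
    (hf : ∀ ⦃a b⦄, r a b → TensorAlgebra.lift k f a = TensorAlgebra.lift k f b) :
    RingQuot r →ₐ[k] Module.End k M :=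
  RingQuot.liftAlgHom k ⟨TensorAlgebra.lift k f, hf⟩

@[simp] theorem act_gen {M : Type u} [AddCommGroup M] [Module k M] (f : V →ₗ[k] Module.End k M)
    (hf : ∀ ⦃a b⦄, r a b → TensorAlgebra.lift k f a = TensorAlgebra.lift k f b) (v : V) :
    act f hf (gen r v) = f v := by
  simp [act, gen]

theorem intertwine {M N : Type u} [AddCommGroup M] [Module k M] [AddCommGroup N] [Module k N]
    (ρ : RingQuot r →ₐ[k] Module.End k M) (σ : RingQuot r →ₐ[k] Module.End k N)
    (φ : M →ₗ[k] N) (h : ∀ v m, φ (ρ (gen r v) m) = σ (gen r v) (φ m)) (a : RingQuot r) (m : M) :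
    φ (ρ a m) = σ a (φ m) := by
  obtain ⟨a, rfl⟩ := RingQuot.mkAlgHom_surjective k r a
  induction a using TensorAlgebra.induction generalizing m with
  | algebraMap t => simp [Algebra.algebraMap_eq_smul_one]
  | ι v => exact h v m
  | mul a b ha hb => simp [ha, hb]
  | add a b ha hb => simp [ha, hb]

end Presented

/-! ### Right modules over a Lie algebra -/

section LieModules

variable (k : Type u) [Field k] (h : Type u) [LieRing h] [LieAlgebra k h]

/-- Right modules over a Lie algebra `h` over `k`: vector spaces with a bilinear right action
`act m x = m x` such that `m [x, y] = (m x) y - (m y) x`. -/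
structure RLieMod where
  carrier : Type u
  [addCommGroup : AddCommGroup carrier]
  [module : Module k carrier]
  act : carrier →ₗ[k] h →ₗ[k] carrier
  act_lie : ∀ m x y, act m ⁅x, y⁆ = act (act m x) y - act (act m y) x

namespace RLieMod

instance : CoeSort (RLieMod k h) (Type u) := ⟨RLieMod.carrier⟩

attribute [instance] RLieMod.addCommGroup RLieMod.module

variable {k h}

/-- The space of morphisms: `k`-linear maps compatible with the actions. -/
def homs (M N : RLieMod k h) : Submodule k (M →ₗ[k] N) where
  carrier := {f | ∀ m x, f (M.act m x) = N.act (f m) x}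
  add_mem' hf hg m x := by
    simp only [Set.mem_ofPred_eq] at hf hg
    simp [hf m x, hg m x]
  zero_mem' m x := by simp
  smul_mem' t f hf m x := by
    simp only [Set.mem_ofPred_eq] at hf
    simp [hf m x]

instance : Category (RLieMod k h) where
  Hom M N := homs M N
  id M := ⟨LinearMap.id, fun _ _ => rfl⟩
  comp f g := ⟨g.1 ∘ₗ f.1, fun m x => by
    change g.1 (f.1 _) = _
    rw [f.2, g.2]; rfl⟩

instance : Preadditive (RLieMod k h) where
  homGroup M N := inferInstanceAs (AddCommGroup (homs M N))
  add_comp _ _ _ f f' g := Subtype.ext (LinearMap.comp_add f.1 f'.1 g.1)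
  comp_add _ _ _ f g g' := Subtype.ext (LinearMap.add_comp f.1 g'.1 g.1)

instance : Linear k (RLieMod k h) where
  homModule M N := inferInstanceAs (Module k (homs M N))
  smul_comp _ _ _ t f g := Subtype.ext (LinearMap.comp_smul g.1 t f.1)
  comp_smul _ _ _ f t g := Subtype.ext (LinearMap.smul_comp t g.1 f.1)

/-- The defining relations of the algebra whose left modules are the right `h`-modules. -/
inductive Rel : TensorAlgebra k h → TensorAlgebra k h → Prop
  | lie (x y : h) : Rel (TensorAlgebra.ι k ⁅x, y⁆)
      (TensorAlgebra.ι k y * TensorAlgebra.ι k x - TensorAlgebra.ι k x * TensorAlgebra.ι k y)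

/-- The action of the presented algebra on a right `h`-module. -/
noncomputable def algAct (M : RLieMod k h) :
    RingQuot (Rel (k := k) (h := h)) →ₐ[k] Module.End k M :=
  Presented.act M.act.flip (by
    rintro _ _ ⟨x, y⟩
    ext m
    simp [M.act_lie])

theorem algAct_gen (M : RLieMod k h) (x : h) :
    M.algAct (Presented.gen _ x) = M.act.flip x :=
  Presented.act_gen _ _ x

variable (k h) in
/-- Right `h`-modules as modules over the presented algebra. -/
noncomputable def toModuleCat :
    RLieMod k h ⥤ ModuleCat.{u} (RingQuot (Rel (k := k) (h := h))) where
  obj M := @ModuleCat.of _ _ M _ (Module.compHom M M.algAct.toRingHom)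
  map {M N} f := @ModuleCat.ofHom _ _ M N _ (Module.compHom M M.algAct.toRingHom) _
    (Module.compHom N N.algAct.toRingHom)
    (letI := Module.compHom M M.algAct.toRingHom
     letI := Module.compHom N N.algAct.toRingHom
     { toFun := f.1
       map_add' := f.1.map_add
       map_smul' := fun a m => Presented.intertwine M.algAct N.algAct f.1
        (fun v m => by simpa [algAct] using f.2 m v) a m })

instance : (toModuleCat k h).Additive where
  map_add := rfl

instance : (toModuleCat k h).Faithful where
  map_injective hfg := Subtype.ext (LinearMap.ext fun m =>
    congrArg (fun φ => φ.hom m) hfg)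

instance : (toModuleCat k h).Full where
  map_surjective {M N} φ := by
    have key : ∀ (a : RingQuot (Rel (k := k) (h := h))) (m : M),
        φ.hom (M.algAct a m : M) = N.algAct a (φ.hom m : N) := fun a m => φ.hom.map_smul a m
    refine ⟨⟨{ toFun := fun m => φ.hom m, map_add' := φ.hom.map_add, map_smul' := ?_ }, ?_⟩, ?_⟩
    · intro t m
      have := key (algebraMap k _ t) m
      rw [AlgHom.commutes, AlgHom.commutes] at this
      exact this
    · intro m x
      have := key (Presented.gen _ x) m
      rw [algAct_gen, algAct_gen] at this
      exact this
    · rfl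

section EssSurj

attribute [local instance] ModuleCat.moduleOfAlgebraModule
  ModuleCat.isScalarTower_of_algebra_moduleCat

/-- The right `h`-module underlying a module over the presented algebra. -/
noncomputable def ofModuleCat (X : ModuleCat.{u} (RingQuot (Rel (k := k) (h := h)))) :
    RLieMod k h where
  carrier := X
  act := ((Algebra.lsmul k k X).toLinearMap ∘ₗ Presented.gen Rel).flip
  act_lie m x y := by
    have := RingQuot.mkAlgHom_rel k (Rel.lie (k := k) x y)
    simp only [map_sub, map_mul] at this
    change RingQuot.mkAlgHom k Rel (TensorAlgebra.ι k ⁅x, y⁆) • m = _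
    rw [this, sub_smul, mul_smul, mul_smul]
    rfl

theorem algAct_ofModuleCat (X : ModuleCat.{u} (RingQuot (Rel (k := k) (h := h))))
    (a : RingQuot (Rel (k := k) (h := h))) (m : X) :
    (ofModuleCat X).algAct a m = a • m := by
  have : (ofModuleCat X).algAct = Algebra.lsmul k k X := by
    apply Presented.hom_ext
    intro v
    rw [algAct_gen]
    rfl
  rw [this]
  rfl

instance : (toModuleCat k h).EssSurj where
  mem_essImage X := by
    let e : ((toModuleCat k h).obj (ofModuleCat X)) ≃ₗ[RingQuot (Rel (k := k) (h := h))] X :=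
      { toFun := fun m => m
        invFun := fun m => m
        left_inv := fun _ => rfl
        right_inv := fun _ => rfl
        map_add' := fun _ _ => rfl
        map_smul' := fun a m => algAct_ofModuleCat X a m }
    exact ⟨ofModuleCat X, ⟨e.toModuleIso⟩⟩

end EssSurj

instance : (toModuleCat k h).IsEquivalence where

instance : HasFiniteLimits (RLieMod k h) :=
  ⟨fun _ _ _ => Adjunction.hasLimitsOfShape_of_equivalence (toModuleCat k h)⟩

instance : HasFiniteProducts (RLieMod k h) := inferInstance

noncomputable instance : Abelian (RLieMod k h) := abelianOfEquivalence (toModuleCat k h)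

instance : EnoughProjectives (RLieMod k h) :=
  (toModuleCat k h).asEquivalence.enoughProjectives_iff.2 ModuleCat.enoughProjectives

instance : HasExt.{u} (RLieMod k h) := hasExt_of_enoughProjectives _

end RLieMod

end LieModules

/-! ### Modules over a Leibniz algebra -/

section LeibnizModules

variable (k : Type u) [Field k] (g : Type u) [NonUnitalNonAssocRing g] [Module k g]

/-- Modules over a Leibniz algebra `g` over `k`: vector spaces with a bilinear left action
`left x m = x m` and a bilinear right action `right m x = m x`, subject to the relations
(MLL), (LML), (LLM) of Loday and Pirashvili. -/
structure LeibMod where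
  carrier : Type u
  [addCommGroup : AddCommGroup carrier]
  [module : Module k carrier]
  left : g →ₗ[k] carrier →ₗ[k] carrier
  right : carrier →ₗ[k] g →ₗ[k] carrier
  mll : ∀ m x y, right m (x * y) = right (right m x) y - right (right m y) x
  lml : ∀ x m y, left x (right m y) = right (left x m) y - left (x * y) m
  llm : ∀ x y m, left x (left y m) = left (x * y) m - right (left x m) y

namespace LeibMod

instance : CoeSort (LeibMod k g) (Type u) := ⟨LeibMod.carrier⟩

attribute [instance] LeibMod.addCommGroup LeibMod.module

variable {k g}

/-- The space of morphisms: `k`-linear maps compatible with both actions. -/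
def homs (M N : LeibMod k g) : Submodule k (M →ₗ[k] N) where
  carrier := {f | (∀ x m, f (M.left x m) = N.left x (f m)) ∧
    ∀ m x, f (M.right m x) = N.right (f m) x}
  add_mem' hf hg := by
    simp only [Set.mem_ofPred_eq] at hf hg
    exact ⟨fun x m => by simp [hf.1 x m, hg.1 x m], fun m x => by simp [hf.2 m x, hg.2 m x]⟩
  zero_mem' := ⟨fun x m => by simp, fun m x => by simp⟩
  smul_mem' t f hf := by
    simp only [Set.mem_ofPred_eq] at hf
    exact ⟨fun x m => by simp [hf.1 x m], fun m x => by simp [hf.2 m x]⟩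

instance : Category (LeibMod k g) where
  Hom M N := homs M N
  id M := ⟨LinearMap.id, fun _ _ => rfl, fun _ _ => rfl⟩
  comp f g := ⟨g.1 ∘ₗ f.1, fun x m => by
    change g.1 (f.1 _) = _
    rw [f.2.1, g.2.1]; rfl, fun m x => by
    change g.1 (f.1 _) = _
    rw [f.2.2, g.2.2]; rfl⟩

instance : Preadditive (LeibMod k g) where
  homGroup M N := inferInstanceAs (AddCommGroup (homs M N))
  add_comp _ _ _ f f' g := Subtype.ext (LinearMap.comp_add f.1 f'.1 g.1)
  comp_add _ _ _ f g g' := Subtype.ext (LinearMap.add_comp f.1 g'.1 g.1)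

instance : Linear k (LeibMod k g) where
  homModule M N := inferInstanceAs (Module k (homs M N))
  smul_comp _ _ _ t f g := Subtype.ext (LinearMap.comp_smul g.1 t f.1)
  comp_smul _ _ _ f t g := Subtype.ext (LinearMap.smul_comp t g.1 f.1)

/-- The generator `l_x`. -/
noncomputable abbrev genL (x : g) : TensorAlgebra k (g × g) := TensorAlgebra.ι k (x, 0)

/-- The generator `r_x`. -/
noncomputable abbrev genR (x : g) : TensorAlgebra k (g × g) := TensorAlgebra.ι k (0, x)

/-- The defining relations of the algebra whose left modules are the `g`-modules (the opposite
of the enveloping algebra of `g`). -/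
inductive Rel : TensorAlgebra k (g × g) → TensorAlgebra k (g × g) → Prop
  | mll (x y : g) : Rel (genR (x * y)) (genR y * genR x - genR x * genR y)
  | lml (x y : g) : Rel (genL x * genR y) (genR y * genL x - genL (x * y))
  | llm (x y : g) : Rel (genL x * genL y) (genL (x * y) - genR y * genL x)

/-- The action of the presented algebra on a `g`-module. -/
noncomputable def algAct (M : LeibMod k g) :
    RingQuot (Rel (k := k) (g := g)) →ₐ[k] Module.End k M :=
  Presented.act (M.left.coprod M.right.flip) (by
    rintro _ _ (⟨x, y⟩ | ⟨x, y⟩ | ⟨x, y⟩)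
    · ext m
      simp [M.mll]
    · ext m
      simp [M.lml]
    · ext m
      simp [M.llm])

theorem algAct_gen (M : LeibMod k g) (v : g × g) (m : M) :
    M.algAct (Presented.gen _ v) m = M.left v.1 m + M.right m v.2 := by
  rw [algAct, Presented.act_gen]; rfl

variable (k g) in
/-- `g`-modules as modules over the presented algebra. -/
noncomputable def toModuleCat :
    LeibMod k g ⥤ ModuleCat.{u} (RingQuot (Rel (k := k) (g := g))) where
  obj M := @ModuleCat.of _ _ M _ (Module.compHom M M.algAct.toRingHom)
  map {M N} f := @ModuleCat.ofHom _ _ M N _ (Module.compHom M M.algAct.toRingHom) _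
    (Module.compHom N N.algAct.toRingHom)
    (letI := Module.compHom M M.algAct.toRingHom
     letI := Module.compHom N N.algAct.toRingHom
     { toFun := f.1
       map_add' := f.1.map_add
       map_smul' := fun a m => Presented.intertwine M.algAct N.algAct f.1
        (fun v m => by rw [algAct_gen, algAct_gen, map_add, f.2.1, f.2.2]) a m })

instance : (toModuleCat k g).Additive where
  map_add := rfl

instance : (toModuleCat k g).Faithful where
  map_injective hfg := Subtype.ext (LinearMap.ext fun m =>
    congrArg (fun φ => φ.hom m) hfg)

instance : (toModuleCat k g).Full where
  map_surjective {M N} φ := by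
    have key : ∀ (a : RingQuot (Rel (k := k) (g := g))) (m : M),
        φ.hom (M.algAct a m : M) = N.algAct a (φ.hom m : N) := fun a m => φ.hom.map_smul a m
    refine ⟨⟨{ toFun := fun m => φ.hom m, map_add' := φ.hom.map_add, map_smul' := ?_ },
      ?_, ?_⟩, ?_⟩
    · intro t m
      have := key (algebraMap k _ t) m
      rw [AlgHom.commutes, AlgHom.commutes] at this
      exact this
    · intro x m
      have e1 := M.algAct_gen (x, 0) m
      have e2 := N.algAct_gen (x, 0) (φ.hom m : N)
      simp only [map_zero, add_zero] at e1 e2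
      exact ((congrArg φ.hom e1).symm.trans (key (Presented.gen _ (x, 0)) m)).trans e2
    · intro m x
      have e1 := M.algAct_gen (0, x) m
      have e2 := N.algAct_gen (0, x) (φ.hom m : N)
      simp only [map_zero, LinearMap.zero_apply, zero_add] at e1 e2
      have e3 := ((congrArg φ.hom e1).symm.trans (key (Presented.gen _ (0, x)) m)).trans e2
      exact e3.trans (zero_add (N.right (φ.hom m : N) x))
    · rfl

variable (k g) in
/-- The generators of the presented algebra. -/
noncomputable abbrev gen : g × g →ₗ[k] RingQuot (Rel (k := k) (g := g)) :=
  Presented.gen (Rel (k := k) (g := g))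

theorem gen_mll (x y : g) : gen k g (0, x * y) =
    gen k g (0, y) * gen k g (0, x) - gen k g (0, x) * gen k g (0, y) := by
  have := RingQuot.mkAlgHom_rel k (Rel.mll (k := k) x y)
  simp only [map_sub, map_mul] at this
  exact this

theorem gen_lml (x y : g) : gen k g (x, 0) * gen k g (0, y) =
    gen k g (0, y) * gen k g (x, 0) - gen k g (x * y, 0) := by
  have := RingQuot.mkAlgHom_rel k (Rel.lml (k := k) x y)
  simp only [map_sub, map_mul] at this
  exact this

theorem gen_llm (x y : g) : gen k g (x, 0) * gen k g (y, 0) =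
    gen k g (x * y, 0) - gen k g (0, y) * gen k g (x, 0) := by
  have := RingQuot.mkAlgHom_rel k (Rel.llm (k := k) x y)
  simp only [map_sub, map_mul] at this
  exact this

section EssSurj

attribute [local instance] ModuleCat.moduleOfAlgebraModule
  ModuleCat.isScalarTower_of_algebra_moduleCat

/-- The `g`-module underlying a module over the presented algebra. -/
noncomputable def ofModuleCat (X : ModuleCat.{u} (RingQuot (Rel (k := k) (g := g)))) :
    LeibMod k g where
  carrier := X
  left := (Algebra.lsmul k k X).toLinearMap ∘ₗ gen k g ∘ₗ LinearMap.inl k g g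
  right := ((Algebra.lsmul k k X).toLinearMap ∘ₗ gen k g ∘ₗ LinearMap.inr k g g).flip
  mll m x y := by
    change gen k g (0, x * y) • (m : X) =
      gen k g (0, y) • gen k g (0, x) • (m : X) - gen k g (0, x) • gen k g (0, y) • (m : X)
    rw [gen_mll, sub_smul, mul_smul, mul_smul]
  lml x m y := by
    change gen k g (x, 0) • gen k g (0, y) • (m : X) =
      gen k g (0, y) • gen k g (x, 0) • (m : X) - gen k g (x * y, 0) • (m : X)
    rw [← mul_smul, gen_lml, sub_smul, mul_smul]
  llm x y m := by
    change gen k g (x, 0) • gen k g (y, 0) • (m : X) =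
      gen k g (x * y, 0) • (m : X) - gen k g (0, y) • gen k g (x, 0) • (m : X)
    rw [← mul_smul, gen_llm, sub_smul, mul_smul]

theorem algAct_ofModuleCat (X : ModuleCat.{u} (RingQuot (Rel (k := k) (g := g))))
    (a : RingQuot (Rel (k := k) (g := g))) (m : X) :
    (ofModuleCat X).algAct a m = a • m := by
  have : (ofModuleCat X).algAct = Algebra.lsmul k k X := by
    apply Presented.hom_ext
    intro v
    refine LinearMap.ext fun (m : X) => ?_
    refine (algAct_gen (ofModuleCat X) v m).trans ?_
    change gen k g (v.1, 0) • m + gen k g (0, v.2) • m = gen k g v • m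
    rw [← add_smul, ← map_add]
    simp
  rw [this]
  rfl

instance : (toModuleCat k g).EssSurj where
  mem_essImage X := by
    let e : ((toModuleCat k g).obj (ofModuleCat X)) ≃ₗ[RingQuot (Rel (k := k) (g := g))] X :=
      { toFun := fun m => m
        invFun := fun m => m
        left_inv := fun _ => rfl
        right_inv := fun _ => rfl
        map_add' := fun _ _ => rfl
        map_smul' := fun a m => algAct_ofModuleCat X a m }
    exact ⟨ofModuleCat X, ⟨e.toModuleIso⟩⟩

end EssSurj

instance : (toModuleCat k g).IsEquivalence where

instance : HasFiniteLimits (LeibMod k g) :=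
  ⟨fun _ _ _ => Adjunction.hasLimitsOfShape_of_equivalence (toModuleCat k g)⟩

noncomputable instance : Abelian (LeibMod k g) := abelianOfEquivalence (toModuleCat k g)

instance : EnoughProjectives (LeibMod k g) :=
  (toModuleCat k g).asEquivalence.enoughProjectives_iff.2 ModuleCat.enoughProjectives

instance : HasExt.{u} (LeibMod k g) := hasExt_of_enoughProjectives _

end LeibMod

end LeibnizModules

/-! ### Tensor products, internal homs and duals of right modules over a Lie algebra -/

namespace RLieMod

variable {k : Type u} [Field k] {h : Type u} [LieRing h] [LieAlgebra k h]

variable (k h) in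
/-- The trivial module `k`. -/
noncomputable def triv : RLieMod k h where
  carrier := k
  act := 0
  act_lie _ _ _ := by simp

/-- The action of a single element, as an endomorphism: `M.actBy x m = m x`. -/
abbrev actBy (M : RLieMod k h) : h →ₗ[k] M →ₗ[k] M := M.act.flip

/-- The diagonal action `(n ⊗ p) x = n x ⊗ p + n ⊗ p x` on `N ⊗ P`. -/
noncomputable def tensorAct (N P : RLieMod k h) :
    ((N : Type u) ⊗[k] (P : Type u)) →ₗ[k] h →ₗ[k] ((N : Type u) ⊗[k] (P : Type u)) :=
  (((LinearMap.rTensorHom (P : Type u)) ∘ₗ N.actBy) +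
    ((LinearMap.lTensorHom (N : Type u)) ∘ₗ P.actBy)).flip

@[simp] theorem tensorAct_tmul (N P : RLieMod k h) (n : N) (p : P) (x : h) :
    tensorAct N P (n ⊗ₜ p) x = (N.act n x) ⊗ₜ[k] p + n ⊗ₜ[k] (P.act p x) := rfl

/-- `N ⊗ P` with the diagonal action. -/
noncomputable def tensorObj (N P : RLieMod k h) : RLieMod k h where
  carrier := (N : Type u) ⊗[k] (P : Type u)
  act := tensorAct N P
  act_lie t x y := by
    induction t using TensorProduct.induction_on with
    | zero => simp
    | add a b ha hb => simp only [map_add, LinearMap.add_apply, ha, hb]; abel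
    | tmul n p =>
      simp [N.act_lie, P.act_lie, tmul_sub, sub_tmul]
      abel

theorem rTensor_tensorAct {M N : RLieMod k h} (P : RLieMod k h) (f : M ⟶ N)
    (t : (M : Type u) ⊗[k] (P : Type u)) (x : h) :
    LinearMap.rTensor P f.1 (tensorAct M P t x) = tensorAct N P (LinearMap.rTensor P f.1 t) x := by
  induction t using TensorProduct.induction_on with
  | zero => simp
  | add a b ha hb => simp only [map_add, LinearMap.add_apply, ha, hb]
  | tmul m p => simp [f.2 m x]

/-- The functor `N ↦ N ⊗ P`. -/
noncomputable def tensorRight (P : RLieMod k h) : RLieMod k h ⥤ RLieMod k h where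
  obj N := tensorObj N P
  map f := ⟨LinearMap.rTensor P f.1, rTensor_tensorAct P f⟩
  map_id _ := Subtype.ext (LinearMap.rTensor_id _ _)
  map_comp f g := Subtype.ext (LinearMap.rTensor_comp _ g.1 f.1)

/-- The action `(f x)(p) = f(p) x - f(p x)` on `Hom_k(P, N)`. -/
noncomputable def homAct (P N : RLieMod k h) :
    ((P : Type u) →ₗ[k] (N : Type u)) →ₗ[k] h →ₗ[k] ((P : Type u) →ₗ[k] (N : Type u)) :=
  ((LinearMap.llcomp k P N N) ∘ₗ N.actBy - (LinearMap.llcomp k P P N).flip ∘ₗ P.actBy).flip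

@[simp] theorem homAct_apply (P N : RLieMod k h) (f : (P : Type u) →ₗ[k] (N : Type u)) (x : h)
    (p : P) : homAct P N f x p = N.act (f p) x - f (P.act p x) := rfl

/-- `Hom_k(P, N)` with the action `(f x)(p) = f(p) x - f(p x)`. -/
noncomputable def homObj (P N : RLieMod k h) : RLieMod k h where
  carrier := (P : Type u) →ₗ[k] (N : Type u)
  act := homAct P N
  act_lie f x y := by
    refine LinearMap.ext fun p => ?_
    simp only [LinearMap.sub_apply, homAct_apply, N.act_lie, P.act_lie, map_sub]
    abel

/-- The functor `N ↦ Hom_k(P, N)`. -/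
noncomputable def homFrom (P : RLieMod k h) : RLieMod k h ⥤ RLieMod k h where
  obj N := homObj P N
  map {M N} f := ⟨LinearMap.llcomp k P M N f.1, fun (φ : (P : Type u) →ₗ[k] (M : Type u)) x =>
    LinearMap.ext fun (p : P) => by
      change f.1 (homAct P M φ x p) = homAct P N (f.1 ∘ₗ φ) x p
      simp [f.2 _ x]⟩

variable (k h) in
/-- The duality functor `N ↦ N^♯ = Hom_k(N, k)`, with the action `(f x)(n) = - f(n x)`. -/
noncomputable def dual : (RLieMod k h)ᵒᵖ ⥤ RLieMod k h where
  obj N := homObj N.unop (triv k h)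
  map {M N} f := ⟨(LinearMap.llcomp k N.unop M.unop (triv k h)).flip f.unop.1,
    fun (φ : (M.unop : Type u) →ₗ[k] (triv k h : Type u)) x =>
    LinearMap.ext fun (p : N.unop) => by
      change homAct M.unop (triv k h) φ x (f.unop.1 p) =
        homAct N.unop (triv k h) (φ ∘ₗ f.unop.1) x p
      simp [f.unop.2 p x]⟩

theorem dual_act_apply (N : RLieMod k h) (f : (N : Type u) →ₗ[k] (triv k h : Type u)) (x : h)
    (n : N) : homAct N (triv k h) f x n = - f (N.act n x) :=
  zero_sub _

end RLieMod

/-! ### Symmetric and antisymmetric modules, restriction, the adjoint module -/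

namespace LeibMod

variable (k : Type u) [Field k] (g : Type u) [NonUnitalNonAssocRing g] [Module k g]
  [IsScalarTower k g g] [SMulCommClass k g g] [IsRightLeibniz g]

/-- The functor `N ↦ N^a`: right action through `g_Lie`, and zero left action. -/
noncomputable def asymF : RLieMod k (LieQuot k g) ⥤ LeibMod k g where
  obj N :=
    { carrier := N
      left := 0
      right := N.act.compl₂ (LieQuot.mk k g)
      mll := fun m x y => by
        simp only [LinearMap.compl₂_apply, ← LieQuot.mk_bracket, N.act_lie]
      lml := fun _ _ _ => by simp
      llm := fun _ _ _ => by simp }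
  map f := ⟨f.1, fun _ _ => by simp, fun m x => f.2 m _⟩

/-- The functor `N ↦ N^s`: right action through `g_Lie`, and left action `x n = - n x`. -/
noncomputable def symF : RLieMod k (LieQuot k g) ⥤ LeibMod k g where
  obj N :=
    { carrier := N
      left := - (N.act.compl₂ (LieQuot.mk k g)).flip
      right := N.act.compl₂ (LieQuot.mk k g)
      mll := fun m x y => by
        simp only [LinearMap.compl₂_apply, ← LieQuot.mk_bracket, N.act_lie]
      lml := fun x m y => by
        simp only [LinearMap.neg_apply, LinearMap.flip_apply, LinearMap.compl₂_apply,
          ← LieQuot.mk_bracket, N.act_lie, map_neg]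
        abel
      llm := fun x y m => by
        simp only [LinearMap.neg_apply, LinearMap.flip_apply, LinearMap.compl₂_apply,
          ← LieQuot.mk_bracket, N.act_lie, map_neg]
        abel }
  map {M N} f := ⟨f.1, fun x (m : M) => by
    change f.1 (-(M.act m (LieQuot.mk k g x))) = -(N.act (f.1 m) (LieQuot.mk k g x))
    rw [map_neg, f.2], fun m x => f.2 m _⟩

/-- The trivial `g`-module `k`. -/
noncomputable def triv : LeibMod k g where
  carrier := k
  left := 0
  right := 0
  mll _ _ _ := by simp
  lml _ _ _ := by simp
  llm _ _ _ := by simp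

/-- The adjoint module. -/
noncomputable def adjoint : LeibMod k g where
  carrier := g
  left := LinearMap.mul k g
  right := LinearMap.mul k g
  mll := IsRightLeibniz.leibniz
  lml := IsRightLeibniz.leibniz
  llm x y z := by
    simp only [LinearMap.mul_apply']
    exact IsRightLeibniz.leibniz x y z

variable {k g} in
/-- The right `g_Lie`-module `M^↓` obtained from a `g`-module by restriction to the right
action: `m x̄ = m x`. -/
noncomputable def restrict (M : LeibMod k g) : RLieMod k (LieQuot k g) where
  carrier := M
  act := (LieQuot.lift M.right.flip (fun x => by
    ext m
    simp [M.mll])).flip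
  act_lie m x y := by
    obtain ⟨x, rfl⟩ := LieQuot.mk_surjective k g x
    obtain ⟨y, rfl⟩ := LieQuot.mk_surjective k g y
    simp [LieQuot.mk_bracket, M.mll]

/-- The right `g_Lie`-module `g^↓`. -/
noncomputable abbrev adjointRestrict : RLieMod k (LieQuot k g) := restrict (adjoint k g)

end LeibMod

/-! ### Ext functors indexed by all integers, and Lie algebra cohomology -/

section ExtFunctors

open Abelian

variable (k : Type u) [Field k] {C : Type (u + 1)} [Category.{u} C] [Abelian C] [Linear k C]
  [HasExt.{u} C]

/-- The functor `Y ↦ Ext^n(X, Y)` to `k`-vector spaces; it is zero for `n < 0`. -/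
noncomputable def extFrom (X : C) : ℤ → C ⥤ ModuleCat.{u} k
  | Int.ofNat n =>
    { obj := fun Y => ModuleCat.of k (Ext.{u} X Y n)
      map := fun f => ModuleCat.ofHom (Ext.postcompOfLinear (Ext.mk₀ f) k X (add_zero n))
      map_id := fun Y => by ext; simp
      map_comp := fun f f' => by ext; simp [← Ext.mk₀_comp_mk₀] }
  | Int.negSucc _ => (Functor.const C).obj (ModuleCat.of k PUnit)

/-- The contravariant functor `X ↦ Ext^n(X, Y)` to `k`-vector spaces; it is zero for `n < 0`. -/
noncomputable def extTo (Y : C) : ℤ → Cᵒᵖ ⥤ ModuleCat.{u} k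
  | Int.ofNat n =>
    { obj := fun X => ModuleCat.of k (Ext.{u} X.unop Y n)
      map := fun f => ModuleCat.ofHom (Ext.precompOfLinear (Ext.mk₀ f.unop) k Y (zero_add n))
      map_id := fun Y => by ext; simp
      map_comp := fun f f' => by ext; simp }
  | Int.negSucc _ => (Functor.const Cᵒᵖ).obj (ModuleCat.of k PUnit)

/-- Lie algebra cohomology `N ↦ H^n(h; N)`, defined as in Cartan and Eilenberg as
`Ext^n(k, N)` for the trivial module `k` in the category of `h`-modules. -/
noncomputable def lieCohomology (h : Type u) [LieRing h] [LieAlgebra k h] (n : ℤ) :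
    RLieMod k h ⥤ ModuleCat.{u} k :=
  extFrom k (RLieMod.triv k h) n

end ExtFunctors

/-! Let `R` restrict a `g`-module to its right action, viewed as a right `g_Lie`-module. Both `N ↦
N^s` and `N ↦ N^a` are exact sections of `R`, and `R` has an exact left adjoint `F` (`freeF`) with
`F N = N ⊕ (N ⊗ g)` and an exact right adjoint `G` (`cofreeF`) with `G N = N ⊕ Hom(g, N)`. The
adjoints of the identifications `R(N^s) = N` and `R(N^a) = N` fit into natural short exact sequences
`0 → (N ⊗ g^↓)^a → F N → N^s → 0` and `0 → N^a → G N → Hom(g^↓, N)^s → 0`.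

An adjunction between exact functors passes to `Ext` in every degree, so `Ext(F M, N^s) ≅ Ext(M,
N)`. This isomorphism factors as `Ext(M, N) → Ext(M^s, N^s) → Ext(F M, N^s)`: apply the exact
functor, then pull back along `F M → M^s`. Pullback is therefore split surjective, and the long
exact sequence of the first short exact sequence breaks up into `Ext^n(M^s, N^s) ≅ Ext^n(M, N) ⊕
Ext^{n-1}((M ⊗ g^↓)^a, N^s)`. Dually, the second sequence gives `Ext^n(M^a, N^a) ≅ Ext^n(M, N) ⊕
Ext^{n-1}(M^a, Hom(g^↓, N)^s)`. The general splittings are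
`bijective_mapExactFunctor_add_extClass_comp` and `bijective_mapExactFunctor_add_comp_extClass`;
their hypotheses come from `bijective_app_comp_mapExactFunctor` and
`bijective_mapExactFunctor_comp_app`.

Setting `M = k` or `N = k` gives the first four isomorphisms, since `k^s = k^a = k` and since
tensor-hom adjunction identifies `Ext(N, k)` over `g_Lie` with `H(g_Lie; N^♯)`. Substituting one
decomposition into another gives the last two. -/

/-! ### Exact functors, natural transformations and adjunctions on Ext -/

namespace CategoryTheory.Abelian.Ext

universe w₁ w₂ w₃ v₁ v₂ v₃ u₁ u₂ u₃

variable {C : Type u₁} [Category.{v₁} C] [Abelian C] [HasExt.{w₁} C]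
  {D : Type u₂} [Category.{v₂} D] [Abelian D] [HasExt.{w₂} D]
  {E : Type u₃} [Category.{v₃} E] [Abelian E] [HasExt.{w₃} E]

/-- Dimension shifting: a class of positive degree dies on a projective cover of `X`, hence factors
through the connecting class. Statements about `Ext` thus reduce by induction to morphisms and
extension classes of short exact sequences. -/
theorem exists_eq_extClass_comp [EnoughProjectives C] {X Y : C} {n : ℕ} (α : Ext.{w₁} X Y (n + 1)) :
    ∃ (K P : C) (i : K ⟶ P) (p : P ⟶ X) (w : i ≫ p = 0)
      (hS : (ShortComplex.mk i p w).ShortExact) (β : Ext.{w₁} K Y n),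
      α = hS.extClass.comp β (add_comm 1 n) := by
  have hS : (ShortComplex.mk (kernel.ι (Projective.π X)) (Projective.π X)
      (kernel.condition _)).ShortExact := { exact := ShortComplex.exact_kernel _ }
  obtain ⟨β, hβ⟩ := contravariant_sequence_exact₃ hS Y α (eq_zero_of_projective _) (add_comm 1 n)
  exact ⟨_, _, _, _, _, hS, β, hβ.symm⟩

section

variable (F G : C ⥤ D) [F.Additive] [PreservesFiniteLimits F] [PreservesFiniteColimits F]
  [G.Additive] [PreservesFiniteLimits G] [PreservesFiniteColimits G]

variable {F G} in
/-- A natural transformation between exact functors is natural with respect to `Ext` classes. -/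
theorem mapExactFunctor_naturality [EnoughProjectives C] (τ : F ⟶ G) {X Y : C} {n : ℕ}
    (α : Ext.{w₁} X Y n) :
    (α.mapExactFunctor F).comp (mk₀ (τ.app Y)) (add_zero n) =
      (mk₀ (τ.app X)).comp (α.mapExactFunctor G) (zero_add n) := by
  induction n generalizing X with
  | zero =>
    obtain ⟨f, rfl⟩ := (mk₀_bijective X Y).2 α
    simp [mapExactFunctor_mk₀]
  | succ n ih =>
    obtain ⟨K, P, i, p, w, hS, β, rfl⟩ := exists_eq_extClass_comp α
    have nat : (hS.extClass.mapExactFunctor F).comp (mk₀ (τ.app K)) (add_zero 1) =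
        (mk₀ (τ.app X)).comp (hS.extClass.mapExactFunctor G) (zero_add 1) := by
      rw [mapExactFunctor_extClass, mapExactFunctor_extClass]
      exact ShortComplex.ShortExact.extClass_naturality (hS.map_of_exact F)
        (hS.map_of_exact G) ((ShortComplex.mk i p w).mapNatTrans τ)
    -- Only the naturality square of the degree-one class is needed from here on, so the class
    -- itself may be arbitrary.
    revert nat
    generalize hS.extClass = e
    intro nat
    dsimp only at e nat
    rw [mapExactFunctor_comp, mapExactFunctor_comp, comp_assoc_of_third_deg_zero, ih,
      ← comp_assoc_of_second_deg_zero, nat]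
    exact comp_assoc _ _ _ _ _ (by omega)

variable (C) in
theorem mapExactFunctor_id [EnoughProjectives C] {X Y : C} {n : ℕ} (α : Ext.{w₁} X Y n) :
    α.mapExactFunctor (𝟭 C) = α := by
  induction n generalizing X with
  | zero =>
    obtain ⟨f, rfl⟩ := (mk₀_bijective X Y).2 α
    simp [mapExactFunctor_mk₀]
  | succ n ih =>
    obtain ⟨K, P, i, p, w, hS, β, rfl⟩ := exists_eq_extClass_comp α
    rw [mapExactFunctor_comp, ih, mapExactFunctor_extClass]
    rfl

theorem mapExactFunctor_mapExactFunctor [EnoughProjectives C] (H : D ⥤ E) [H.Additive]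
    [PreservesFiniteLimits H] [PreservesFiniteColimits H] {X Y : C} {n : ℕ}
    (α : Ext.{w₁} X Y n) :
    (α.mapExactFunctor F).mapExactFunctor H = α.mapExactFunctor (F ⋙ H) := by
  induction n generalizing X with
  | zero =>
    obtain ⟨f, rfl⟩ := (mk₀_bijective X Y).2 α
    simp [mapExactFunctor_mk₀]
  | succ n ih =>
    obtain ⟨K, P, i, p, w, hS, β, rfl⟩ := exists_eq_extClass_comp α
    have key : (hS.extClass.mapExactFunctor F).mapExactFunctor H =
        hS.extClass.mapExactFunctor (F ⋙ H) := by
      rw [mapExactFunctor_extClass, mapExactFunctor_extClass]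
      exact mapExactFunctor_extClass H (hS.map_of_exact F)
    rw [mapExactFunctor_comp, mapExactFunctor_comp, mapExactFunctor_comp, ih]
    exact congrArg (fun z => Ext.comp z (β.mapExactFunctor (F ⋙ H)) (add_comm 1 n)) key

end

section Adjunction

variable {F : C ⥤ D} {R : D ⥤ C} (adj : F ⊣ R)
  [F.Additive] [PreservesFiniteLimits F] [PreservesFiniteColimits F]
  [R.Additive] [PreservesFiniteLimits R] [PreservesFiniteColimits R]

/-- This is naturality of the unit `𝟭 ⟶ F ⋙ R` on `Ext` classes; the next lemma is the same for the
counit. With the triangle identities they make the usual adjunction bijection work in every degree.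
-/
theorem map_unit_comp [EnoughProjectives C] {X Y : C} {n : ℕ} (α : Ext.{w₁} X Y n) :
    (mk₀ (X := X) (adj.unit.app X)).comp ((α.mapExactFunctor F).mapExactFunctor R) (zero_add n) =
      α.comp (mk₀ (X := Y) (adj.unit.app Y)) (add_zero n) := by
  rw [mapExactFunctor_mapExactFunctor, ← mapExactFunctor_naturality, mapExactFunctor_id]

theorem map_comp_counit [EnoughProjectives D] {X Y : D} {n : ℕ} (α : Ext.{w₂} X Y n) :
    ((α.mapExactFunctor R).mapExactFunctor F).comp (mk₀ (Y := Y) (adj.counit.app Y)) (add_zero n) =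
      (mk₀ (Y := X) (adj.counit.app X)).comp α (zero_add n) := by
  rw [mapExactFunctor_mapExactFunctor, mapExactFunctor_naturality, mapExactFunctor_id]

variable [EnoughProjectives C] [EnoughProjectives D]

/-- For an adjunction between exact functors, the adjoint of an `Ext` class. -/
theorem bijective_mapExactFunctor_comp_counit (X : C) (Y : D) (n : ℕ) :
    Function.Bijective fun α : Ext.{w₁} X (R.obj Y) n =>
      (α.mapExactFunctor F).comp (mk₀ (Y := Y) (adj.counit.app Y)) (add_zero n) := by
  -- The inverse applies `R` and precomposes with the unit. Each round trip collapses, by naturality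
  -- of the unit or counit, to one triangle identity.
  refine Function.bijective_iff_has_inverse.2 ⟨fun β =>
    (mk₀ (X := X) (adj.unit.app X)).comp (β.mapExactFunctor R) (zero_add n), fun α => ?_, fun β => ?_⟩
  · dsimp only
    rw [mapExactFunctor_comp, mapExactFunctor_mk₀, ← comp_assoc_of_third_deg_zero, map_unit_comp,
      comp_assoc_of_third_deg_zero, mk₀_comp_mk₀, adj.right_triangle_components, comp_mk₀_id]
  · dsimp only
    rw [mapExactFunctor_comp, mapExactFunctor_mk₀, comp_assoc_of_third_deg_zero, map_comp_counit,
      mk₀_comp_mk₀_assoc, adj.left_triangle_components, mk₀_id_comp]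

/-- The same mutually inverse pair of maps, read in the opposite direction. -/
theorem bijective_unit_comp_mapExactFunctor (X : C) (Y : D) (n : ℕ) :
    Function.Bijective fun β : Ext.{w₂} (F.obj X) Y n =>
      (mk₀ (X := X) (adj.unit.app X)).comp (β.mapExactFunctor R) (zero_add n) := by
  refine Function.bijective_iff_has_inverse.2 ⟨fun α =>
    (α.mapExactFunctor F).comp (mk₀ (Y := Y) (adj.counit.app Y)) (add_zero n), fun β => ?_, fun α => ?_⟩
  · dsimp only
    rw [mapExactFunctor_comp, mapExactFunctor_mk₀, comp_assoc_of_third_deg_zero, map_comp_counit,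
      mk₀_comp_mk₀_assoc, adj.left_triangle_components, mk₀_id_comp]
  · dsimp only
    rw [mapExactFunctor_comp, mapExactFunctor_mk₀, ← comp_assoc_of_third_deg_zero, map_unit_comp,
      comp_assoc_of_third_deg_zero, mk₀_comp_mk₀, adj.right_triangle_components, comp_mk₀_id]

end Adjunction

end CategoryTheory.Abelian.Ext

/-! ### Direct sum decompositions of functors to vector spaces -/

section ModuleValuedFunctors

variable {k : Type u} [Field k] {J : Type*} [Category J]

/-- The map out of the biproduct with components `i` and `d` is an isomorphism as soon as it is one
at each object. The biproduct of functors is only known abstractly, so elements of its values are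
split by means of `biprod.total`. -/
theorem nonempty_iso_biprod {E A B : J ⥤ ModuleCat.{u} k} (i : A ⟶ E) (d : B ⟶ E)
    (h : ∀ j, Function.Bijective fun p : A.obj j × B.obj j => i.app j p.1 + d.app j p.2) :
    Nonempty (E ≅ A ⊞ B) := by
  suffices IsIso (biprod.desc i d) from ⟨(asIso (biprod.desc i d)).symm⟩
  rw [NatTrans.isIso_iff_isIso_app]
  intro j
  have hl (a : A.obj j) : (biprod.desc i d).app j ((biprod.inl : A ⟶ A ⊞ B).app j a) =
      i.app j a := by
    rw [← ModuleCat.comp_apply, ← NatTrans.comp_app, biprod.inl_desc]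
  have hr (b : B.obj j) : (biprod.desc i d).app j ((biprod.inr : B ⟶ A ⊞ B).app j b) =
      d.app j b := by
    rw [← ModuleCat.comp_apply, ← NatTrans.comp_app, biprod.inr_desc]
  have htot (z : (A ⊞ B).obj j) : z = (biprod.inl : A ⟶ A ⊞ B).app j
      ((biprod.fst : A ⊞ B ⟶ A).app j z) + (biprod.inr : B ⟶ A ⊞ B).app j
      ((biprod.snd : A ⊞ B ⟶ B).app j z) := by
    have := congrArg (fun f : A ⊞ B ⟶ A ⊞ B => f.app j z) (biprod.total (X := A) (Y := B))
    exact this.symm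
  rw [ConcreteCategory.isIso_iff_bijective]
  refine ⟨(injective_iff_map_eq_zero ((biprod.desc i d).app j).hom).2 fun z hz => ?_, fun e => ?_⟩
  · rw [htot z]
    rw [htot z, map_add] at hz
    have hz' := (congrArg₂ (· + ·) (hl _) (hr _)).symm.trans hz
    have := @(h j).1 ((biprod.fst : A ⊞ B ⟶ A).app j z, (biprod.snd : A ⊞ B ⟶ B).app j z) (0, 0)
      (by simpa using hz')
    rw [Prod.mk.injEq] at this
    rw [this.1, this.2, map_zero, map_zero, add_zero]
  · obtain ⟨⟨a, b⟩, hab⟩ := (h j).2 e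
    refine ⟨(biprod.inl : A ⟶ A ⊞ B).app j a + (biprod.inr : B ⟶ A ⊞ B).app j b, ?_⟩
    rw [map_add, hl, hr]
    exact hab

/-- Reduction of a decomposition of `ℤ`-indexed functors vanishing in negative degrees to
nonnegative degrees. -/
theorem nonempty_iso_biprod_shift (E A B : ℤ → J ⥤ ModuleCat.{u} k)
    (hE : ∀ (m : ℕ) (j : J), Subsingleton ((E (Int.negSucc m)).obj j))
    (hA : ∀ (m : ℕ) (j : J), Subsingleton ((A (Int.negSucc m)).obj j))
    (hB : ∀ (m : ℕ) (j : J), Subsingleton ((B (Int.negSucc m)).obj j))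
    (h₀ : ∃ i : A (Int.ofNat 0) ⟶ E (Int.ofNat 0), ∀ j, Function.Bijective (i.app j))
    (hs : ∀ m : ℕ, ∃ (i : A (Int.ofNat (m + 1)) ⟶ E (Int.ofNat (m + 1)))
      (d : B (Int.ofNat m) ⟶ E (Int.ofNat (m + 1))), ∀ j, Function.Bijective
        fun p : (A (Int.ofNat (m + 1))).obj j × (B (Int.ofNat m)).obj j =>
          i.app j p.1 + d.app j p.2) (n : ℤ) :
    Nonempty (E n ≅ A n ⊞ B (n - 1)) := by
  match n with
  | Int.ofNat 0 =>
    obtain ⟨i, hi⟩ := h₀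
    -- In degree `0` the second summand sits in degree `-1` and vanishes, so the zero map serves as
    -- connecting map.
    refine nonempty_iso_biprod i 0 fun j => ⟨?_, fun e => ?_⟩
    · rintro ⟨a, b⟩ ⟨a', b'⟩ hab
      have hs : Subsingleton ((B (Int.ofNat 0 - 1)).obj j) := hB 0 j
      exact Prod.ext ((hi j).1 (by simpa using hab)) (Subsingleton.elim _ _)
    · obtain ⟨a, ha⟩ := (hi j).2 e
      exact ⟨(a, 0), by simpa using ha⟩
  | Int.ofNat (m + 1) =>
    obtain ⟨i, d, h⟩ := hs m
    have hm : Int.ofNat (m + 1) - 1 = Int.ofNat m := by simp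
    rw [hm]
    exact nonempty_iso_biprod i d h
  | Int.negSucc m =>
    -- In negative degrees all three functors vanish; `negSucc m - 1` is `negSucc (m + 1)`.
    refine nonempty_iso_biprod 0 0 fun j => ?_
    have hs : Subsingleton ((B (Int.negSucc m - 1)).obj j) := hB (m + 1) j
    have := hA m j
    have := hE m j
    exact ⟨Function.injective_of_subsingleton _, fun e => ⟨0, Subsingleton.elim _ _⟩⟩

end ModuleValuedFunctors

/-! ### Splitting the long exact sequence of Ext -/

section Decomposition

open Abelian

variable (k : Type u) [Field k] {C : Type (u + 1)} [Category.{u} C] [Abelian C] [Linear k C]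
  [HasExt.{u} C]

theorem subsingleton_extFrom_negSucc (X : C) (m : ℕ) (Y : C) :
    Subsingleton ((extFrom k X (Int.negSucc m)).obj Y) :=
  inferInstanceAs (Subsingleton PUnit)

theorem subsingleton_extTo_negSucc (Y : C) (m : ℕ) (X : Cᵒᵖ) :
    Subsingleton ((extTo k Y (Int.negSucc m)).obj X) :=
  inferInstanceAs (Subsingleton PUnit)

/-- `extFrom` is contravariant in the object. -/
noncomputable def extFromMap {X X' : C} (f : X' ⟶ X) (n : ℕ) :
    extFrom k X (Int.ofNat n) ⟶ extFrom k X' (Int.ofNat n) where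
  app Y := ModuleCat.ofHom (Ext.precompOfLinear (Ext.mk₀ f) k Y (zero_add n))
  naturality Y Y' φ := by
    ext α
    change Ext X Y n at α
    exact (Ext.comp_assoc_of_third_deg_zero (Ext.mk₀ f) α (Ext.mk₀ φ) (zero_add n)).symm

theorem extFromMap_comp_extFromMap {X X' : C} (f : X' ⟶ X) (f' : X ⟶ X') (h : f' ≫ f = 𝟙 X)
    (n : ℕ) : extFromMap k f n ≫ extFromMap k f' n = 𝟙 _ := by
  ext Y α
  change Ext X Y n at α
  change (Ext.mk₀ f').comp ((Ext.mk₀ f).comp α (zero_add n)) (zero_add n) = α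
  rw [Ext.mk₀_comp_mk₀_assoc, h, Ext.mk₀_id_comp]

/-- `extFrom` depends on the object only up to isomorphism. -/
theorem nonempty_extFrom_iso {X X' : C} (e : X ≅ X') (n : ℤ) :
    Nonempty (extFrom k X n ≅ extFrom k X' n) := by
  match n with
  | Int.ofNat n =>
    exact ⟨⟨extFromMap k e.inv n, extFromMap k e.hom n,
      extFromMap_comp_extFromMap k _ _ e.hom_inv_id n,
      extFromMap_comp_extFromMap k _ _ e.inv_hom_id n⟩⟩
  | Int.negSucc n => exact ⟨Iso.refl _⟩

variable {D : Type (u + 1)} [Category.{u} D] [Abelian D] [Linear k D] [HasExt.{u} D]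
  (T : C ⥤ D) [T.Additive] [T.Linear k] [PreservesFiniteLimits T] [PreservesFiniteColimits T]

/-- The action of an exact functor on `Ext`, natural in the second variable. -/
noncomputable def mapExtFrom (M : C) (n : ℕ) :
    extFrom k M (Int.ofNat n) ⟶ T ⋙ extFrom k (T.obj M) (Int.ofNat n) where
  app N := ModuleCat.ofHom (T.mapExtLinearMap k M N n)
  naturality N N' f := by
    ext α
    change Ext M N n at α
    change (α.comp (Ext.mk₀ f) (add_zero n)).mapExactFunctor T =
      (α.mapExactFunctor T).comp (Ext.mk₀ (T.map f)) (add_zero n)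
    rw [Ext.mapExactFunctor_comp, Ext.mapExactFunctor_mk₀]

/-- The action of an exact functor on `Ext`, natural in the first variable. -/
noncomputable def mapExtTo (N : C) (n : ℕ) :
    extTo k N (Int.ofNat n) ⟶ T.op ⋙ extTo k (T.obj N) (Int.ofNat n) where
  app M := ModuleCat.ofHom (T.mapExtLinearMap k M.unop N n)
  naturality M M' f := by
    ext α
    change Ext M.unop N n at α
    change ((Ext.mk₀ f.unop).comp α (zero_add n)).mapExactFunctor T =
      (Ext.mk₀ (T.map f.unop)).comp (α.mapExactFunctor T) (zero_add n)
    rw [Ext.mapExactFunctor_comp, Ext.mapExactFunctor_mk₀]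

/-! ### Splitting along natural sequences `0 → K → F → T → 0` -/

section Sub

variable {k T} {F K : C ⥤ D} {ι : K ⟶ F} {ε : F ⟶ T} {w : ∀ M, ι.app M ≫ ε.app M = 0}
  (hS : ∀ M, (ShortComplex.mk _ _ (w M)).ShortExact)

include hS

omit [Abelian C] [HasExt C] [T.Additive] [PreservesFiniteLimits T]
  [PreservesFiniteColimits T] in
theorem extClass_comp_app {M M' : C} (f : M ⟶ M') :
    (hS M).extClass.comp (Ext.mk₀ (K.map f)) (add_zero 1) =
      (Ext.mk₀ (T.map f)).comp (hS M').extClass (zero_add 1) :=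
  ShortComplex.ShortExact.extClass_naturality (hS M) (hS M')
    { τ₁ := K.map f, τ₂ := F.map f, τ₃ := T.map f }

variable {M N : C}

/-- Precomposition with the epimorphism `ε` is injective on `Ext^0`, so it cancels from the
bijective composite. -/
theorem bijective_mapExactFunctor_zero_of_precomp (h : Function.Bijective
    fun α : Ext M N 0 => (Ext.mk₀ (ε.app M)).comp (α.mapExactFunctor T) (zero_add 0)) :
    Function.Bijective fun α : Ext M N 0 => α.mapExactFunctor T := by
  have : Epi (ε.app M) := (hS M).epi_g
  refine ⟨fun α β hαβ => h.1 (congrArg (fun z =>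
    (Ext.mk₀ (ε.app M)).comp z (zero_add 0)) hαβ), fun e => ?_⟩
  obtain ⟨α, hα⟩ := h.2 ((Ext.mk₀ (ε.app M)).comp e (zero_add 0))
  exact ⟨α, Ext.precomp_mk₀_injective_of_epi _ (ε.app M) hα⟩

/-- By `h`, pullback along `ε` is surjective in every degree, with `T` providing a section up to a
bijection. Hence the connecting map is injective, its image is the kernel of pullback along `ε`, and
the image of `T` is a complement of that kernel. -/
theorem bijective_mapExactFunctor_add_extClass_comp
    (h : ∀ n : ℕ, Function.Bijective fun α : Ext M N n =>
      (Ext.mk₀ (ε.app M)).comp (α.mapExactFunctor T) (zero_add n)) (n : ℕ) :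
    Function.Bijective fun p : Ext M N (n + 1) × Ext (K.obj M) (T.obj N) n =>
      p.1.mapExactFunctor T + (hS M).extClass.comp p.2 (add_comm 1 n) := by
  have hz (x : Ext (K.obj M) (T.obj N) n) :
      (Ext.mk₀ (ε.app M)).comp ((hS M).extClass.comp x (add_comm 1 n)) (zero_add (n + 1)) = 0 :=
    (hS M).comp_extClass_assoc x (add_comm 1 n)
  let Φ : Ext M N (n + 1) × Ext (K.obj M) (T.obj N) n →+ Ext (T.obj M) (T.obj N) (n + 1) :=
    (T.mapExtAddHom M N (n + 1)).coprod ((hS M).extClass.precomp _ (add_comm 1 n))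
  change Function.Bijective Φ
  refine ⟨(injective_iff_map_eq_zero Φ).2 ?_, fun e => ?_⟩
  · rintro ⟨α, x⟩ hαx
    change α.mapExactFunctor T + (hS M).extClass.comp x (add_comm 1 n) = 0 at hαx
    -- Pullback along `ε` kills the connecting term, leaving the injective map of `h` applied to
    -- `α`.
    have hα : α = 0 := by
      refine (h (n + 1)).1 ?_
      have := congrArg (fun z => (Ext.mk₀ (ε.app M)).comp z (zero_add (n + 1))) hαx
      simpa [hz] using this
    subst hα
    rw [Ext.mapExactFunctor_zero, zero_add] at hαx
    -- By exactness `x` is the pullback along `ι` of some `y`. By `h`, `y` itself is pulled back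
    -- along `ε`, and `ι ≫ ε = 0` forces `x = 0`.
    obtain ⟨y, hy⟩ := Ext.contravariant_sequence_exact₁ (hS M) _ x (add_comm 1 n) hαx
    obtain ⟨β, hβ⟩ := (h n).2 y
    refine Prod.ext rfl (hy.symm.trans ?_)
    simp [← hβ, w M]
  · obtain ⟨α, hα⟩ := (h (n + 1)).2 ((Ext.mk₀ (ε.app M)).comp e (zero_add (n + 1)))
    obtain ⟨x, hx⟩ := Ext.contravariant_sequence_exact₃ (hS M) _ (e - α.mapExactFunctor T)
      (by rw [sub_eq_add_neg, Ext.comp_add, Ext.comp_neg]; exact add_neg_eq_zero.2 hα.symm)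
      (add_comm 1 n)
    refine ⟨(α, x), ?_⟩
    change α.mapExactFunctor T + (hS M).extClass.comp x (add_comm 1 n) = e
    rw [hx, add_sub_cancel]

omit hS [T.Additive] [T.Linear k] [PreservesFiniteLimits T] [PreservesFiniteColimits T] in
variable (k) in
/-- The connecting map, natural in the second variable. -/
noncomputable def connectingFrom (hS : ∀ M, (ShortComplex.mk _ _ (w M)).ShortExact)
    (M : C) (n : ℕ) :
    T ⋙ extFrom k (K.obj M) (Int.ofNat n) ⟶ T ⋙ extFrom k (T.obj M) (Int.ofNat (n + 1)) where
  app N := ModuleCat.ofHom (Ext.precompOfLinear (hS M).extClass k (T.obj N) (add_comm 1 n))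
  naturality N N' f := by
    ext α
    change Ext (K.obj M) (T.obj N) n at α
    exact (Ext.comp_assoc_of_third_deg_zero (hS M).extClass α (Ext.mk₀ (T.map f))
      (add_comm 1 n)).symm

omit hS [T.Additive] [T.Linear k] [PreservesFiniteLimits T] [PreservesFiniteColimits T] in
variable (k) in
/-- The connecting map, natural in the first variable. -/
noncomputable def connectingTo (hS : ∀ M, (ShortComplex.mk _ _ (w M)).ShortExact)
    (Y : D) (n : ℕ) :
    K.op ⋙ extTo k Y (Int.ofNat n) ⟶ T.op ⋙ extTo k Y (Int.ofNat (n + 1)) where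
  app M := ModuleCat.ofHom (Ext.precompOfLinear (hS M.unop).extClass k Y (add_comm 1 n))
  naturality M M' f := by
    ext α
    change Ext (K.obj M.unop) Y n at α
    change (hS M'.unop).extClass.comp ((Ext.mk₀ (K.map f.unop)).comp α (zero_add n))
      (add_comm 1 n) = (Ext.mk₀ (T.map f.unop)).comp
        ((hS M.unop).extClass.comp α (add_comm 1 n)) (zero_add (n + 1))
    have := extClass_comp_app hS f.unop
    dsimp only at this
    rw [← Ext.comp_assoc_of_second_deg_zero, this]
    exact Ext.comp_assoc _ _ _ _ _ (by omega)

variable (k) in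
theorem nonempty_extFrom_iso_biprod_of_sub (M : C)
    (h : ∀ (N : C) (n : ℕ), Function.Bijective fun α : Ext M N n =>
      (Ext.mk₀ (ε.app M)).comp (α.mapExactFunctor T) (zero_add n)) (n : ℤ) :
    Nonempty (T ⋙ extFrom k (T.obj M) n ≅
      extFrom k M n ⊞ (T ⋙ extFrom k (K.obj M) (n - 1))) :=
  nonempty_iso_biprod_shift (fun n => T ⋙ extFrom k (T.obj M) n) (fun n => extFrom k M n)
    (fun n => T ⋙ extFrom k (K.obj M) n)
    (fun m N => subsingleton_extFrom_negSucc k (T.obj M) m (T.obj N))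
    (subsingleton_extFrom_negSucc k M)
    (fun m N => subsingleton_extFrom_negSucc k (K.obj M) m (T.obj N))
    ⟨mapExtFrom k T M 0, fun N => bijective_mapExactFunctor_zero_of_precomp hS (h N 0)⟩
    (fun m => ⟨mapExtFrom k T M (m + 1), connectingFrom k hS M m,
      fun N => bijective_mapExactFunctor_add_extClass_comp hS (h N) m⟩) n

variable (k) in
theorem nonempty_extTo_iso_biprod_of_sub (N : C)
    (h : ∀ (M : C) (n : ℕ), Function.Bijective fun α : Ext M N n =>
      (Ext.mk₀ (ε.app M)).comp (α.mapExactFunctor T) (zero_add n)) (n : ℤ) :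
    Nonempty (T.op ⋙ extTo k (T.obj N) n ≅
      extTo k N n ⊞ (K.op ⋙ extTo k (T.obj N) (n - 1))) :=
  nonempty_iso_biprod_shift (fun n => T.op ⋙ extTo k (T.obj N) n) (fun n => extTo k N n)
    (fun n => K.op ⋙ extTo k (T.obj N) n)
    (fun m M => subsingleton_extTo_negSucc k (T.obj N) m (T.op.obj M))
    (subsingleton_extTo_negSucc k N)
    (fun m M => subsingleton_extTo_negSucc k (T.obj N) m (K.op.obj M))
    ⟨mapExtTo k T N 0, fun M => bijective_mapExactFunctor_zero_of_precomp hS (h M.unop 0)⟩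
    (fun m => ⟨mapExtTo k T N (m + 1), connectingTo k hS (T.obj N) m,
      fun M => bijective_mapExactFunctor_add_extClass_comp hS (h M.unop) m⟩) n

end Sub

/-! ### Splitting along natural sequences `0 → T → G → Q → 0` -/

section Quotient

variable {k T} {G Q : C ⥤ D} {η : T ⟶ G} {π : G ⟶ Q} {w : ∀ N, η.app N ≫ π.app N = 0}
  (hS : ∀ N, (ShortComplex.mk _ _ (w N)).ShortExact)

include hS

variable {M N : C}

theorem bijective_mapExactFunctor_zero_of_postcomp (h : Function.Bijective
    fun α : Ext M N 0 => (α.mapExactFunctor T).comp (Ext.mk₀ (η.app N)) (add_zero 0)) :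
    Function.Bijective fun α : Ext M N 0 => α.mapExactFunctor T := by
  have : Mono (η.app N) := (hS N).mono_f
  refine ⟨fun α β hαβ => h.1 (congrArg (fun z => Ext.comp z (Ext.mk₀ (η.app N)) (add_zero 0)) hαβ),
    fun e => ?_⟩
  obtain ⟨α, hα⟩ := h.2 (e.comp (Ext.mk₀ (η.app N)) (add_zero 0))
  exact ⟨α, Ext.postcomp_mk₀_injective_of_mono _ (η.app N) hα⟩

/-- Dual to the previous splitting: pushforward along `η` is surjective by `h`, so the covariant
long exact sequence breaks up and the image of `T` complements the image of the connecting map. -/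
theorem bijective_mapExactFunctor_add_comp_extClass
    (h : ∀ n : ℕ, Function.Bijective fun α : Ext M N n =>
      (α.mapExactFunctor T).comp (Ext.mk₀ (η.app N)) (add_zero n)) (n : ℕ) :
    Function.Bijective fun p : Ext M N (n + 1) × Ext (T.obj M) (Q.obj N) n =>
      p.1.mapExactFunctor T + p.2.comp (hS N).extClass rfl := by
  have hz (x : Ext (T.obj M) (Q.obj N) n) :
      (x.comp (hS N).extClass rfl).comp (Ext.mk₀ (η.app N)) (add_zero (n + 1)) = 0 := by
    have := (hS N).extClass_comp
    dsimp only at this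
    rw [Ext.comp_assoc_of_third_deg_zero, this, Ext.comp_zero]
  let Φ : Ext M N (n + 1) × Ext (T.obj M) (Q.obj N) n →+ Ext (T.obj M) (T.obj N) (n + 1) :=
    (T.mapExtAddHom M N (n + 1)).coprod ((hS N).extClass.postcomp _ rfl)
  change Function.Bijective Φ
  refine ⟨(injective_iff_map_eq_zero Φ).2 ?_, fun e => ?_⟩
  · rintro ⟨α, x⟩ hαx
    change α.mapExactFunctor T + x.comp (hS N).extClass rfl = 0 at hαx
    have hα : α = 0 := by
      refine (h (n + 1)).1 ?_
      have := congrArg (fun z => Ext.comp z (Ext.mk₀ (η.app N)) (add_zero (n + 1))) hαx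
      simpa [hz] using this
    subst hα
    rw [Ext.mapExactFunctor_zero, zero_add] at hαx
    obtain ⟨y, hy⟩ := Ext.covariant_sequence_exact₃ _ (hS N) x rfl hαx
    obtain ⟨β, hβ⟩ := (h n).2 y
    refine Prod.ext rfl (hy.symm.trans ?_)
    simp [← hβ, w N]
  · obtain ⟨α, hα⟩ := (h (n + 1)).2 (e.comp (Ext.mk₀ (η.app N)) (add_zero (n + 1)))
    obtain ⟨x, hx⟩ := Ext.covariant_sequence_exact₁ _ (hS N) (e - α.mapExactFunctor T)
      (by rw [sub_eq_add_neg, Ext.add_comp, Ext.neg_comp]; exact add_neg_eq_zero.2 hα.symm)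
      rfl
    refine ⟨(α, x), ?_⟩
    change α.mapExactFunctor T + x.comp (hS N).extClass rfl = e
    rw [hx, add_sub_cancel]

omit hS [T.Additive] [T.Linear k] [PreservesFiniteLimits T] [PreservesFiniteColimits T] in
variable (k) in
/-- The connecting map, natural in the second variable. -/
noncomputable def coconnectingFrom (hS : ∀ N, (ShortComplex.mk _ _ (w N)).ShortExact)
    (X : D) (n : ℕ) :
    Q ⋙ extFrom k X (Int.ofNat n) ⟶ T ⋙ extFrom k X (Int.ofNat (n + 1)) where
  app N := ModuleCat.ofHom (Ext.postcompOfLinear (hS N).extClass k X rfl)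
  naturality N N' f := by
    ext α
    change Ext X (Q.obj N) n at α
    change (α.comp (Ext.mk₀ (Q.map f)) (add_zero n)).comp (hS N').extClass rfl =
      (α.comp (hS N).extClass rfl).comp (Ext.mk₀ (T.map f)) (add_zero (n + 1))
    have := ShortComplex.ShortExact.extClass_naturality (hS N) (hS N')
      { τ₁ := T.map f, τ₂ := G.map f, τ₃ := Q.map f }
    dsimp only at this
    rw [Ext.comp_assoc_of_second_deg_zero, ← this]
    exact (Ext.comp_assoc_of_third_deg_zero _ _ _ _).symm

omit hS [T.Additive] [T.Linear k] [PreservesFiniteLimits T] [PreservesFiniteColimits T] in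
variable (k) in
/-- The connecting map, natural in the first variable. -/
noncomputable def coconnectingTo (hS : ∀ N, (ShortComplex.mk _ _ (w N)).ShortExact)
    (N : C) (n : ℕ) :
    T.op ⋙ extTo k (Q.obj N) (Int.ofNat n) ⟶ T.op ⋙ extTo k (T.obj N) (Int.ofNat (n + 1)) where
  app M := ModuleCat.ofHom (Ext.postcompOfLinear (hS N).extClass k (T.obj M.unop) rfl)
  naturality M M' f := by
    ext α
    change Ext (T.obj M.unop) (Q.obj N) n at α
    exact Ext.comp_assoc (Ext.mk₀ (T.map f.unop)) α (hS N).extClass (zero_add n) rfl (by omega)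

variable (k) in
theorem nonempty_extFrom_iso_biprod_of_quotient (M : C)
    (h : ∀ (N : C) (n : ℕ), Function.Bijective fun α : Ext M N n =>
      (α.mapExactFunctor T).comp (Ext.mk₀ (η.app N)) (add_zero n)) (n : ℤ) :
    Nonempty (T ⋙ extFrom k (T.obj M) n ≅
      extFrom k M n ⊞ (Q ⋙ extFrom k (T.obj M) (n - 1))) :=
  nonempty_iso_biprod_shift (fun n => T ⋙ extFrom k (T.obj M) n) (fun n => extFrom k M n)
    (fun n => Q ⋙ extFrom k (T.obj M) n)
    (fun m N => subsingleton_extFrom_negSucc k (T.obj M) m (T.obj N))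
    (subsingleton_extFrom_negSucc k M)
    (fun m N => subsingleton_extFrom_negSucc k (T.obj M) m (Q.obj N))
    ⟨mapExtFrom k T M 0, fun N => bijective_mapExactFunctor_zero_of_postcomp hS (h N 0)⟩
    (fun m => ⟨mapExtFrom k T M (m + 1), coconnectingFrom k hS (T.obj M) m,
      fun N => bijective_mapExactFunctor_add_comp_extClass hS (h N) m⟩) n

variable (k) in
theorem nonempty_extTo_iso_biprod_of_quotient (N : C)
    (h : ∀ (M : C) (n : ℕ), Function.Bijective fun α : Ext M N n =>
      (α.mapExactFunctor T).comp (Ext.mk₀ (η.app N)) (add_zero n)) (n : ℤ) :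
    Nonempty (T.op ⋙ extTo k (T.obj N) n ≅
      extTo k N n ⊞ (T.op ⋙ extTo k (Q.obj N) (n - 1))) :=
  nonempty_iso_biprod_shift (fun n => T.op ⋙ extTo k (T.obj N) n) (fun n => extTo k N n)
    (fun n => T.op ⋙ extTo k (Q.obj N) n)
    (fun m M => subsingleton_extTo_negSucc k (T.obj N) m (T.op.obj M))
    (subsingleton_extTo_negSucc k N)
    (fun m M => subsingleton_extTo_negSucc k (Q.obj N) m (T.op.obj M))
    ⟨mapExtTo k T N 0, fun M => bijective_mapExactFunctor_zero_of_postcomp hS (h M.unop 0)⟩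
    (fun m => ⟨mapExtTo k T N (m + 1), coconnectingTo k hS N m,
      fun M => bijective_mapExactFunctor_add_comp_extClass hS (h M.unop) m⟩) n

end Quotient

end Decomposition

/-! ### Comparison maps from adjoints of a retraction -/

section AdjunctionComparison

open Abelian

universe w₁ w₂ v₁ v₂ u₁ u₂

variable {C : Type u₁} [Category.{v₁} C] [Abelian C] [HasExt.{w₁} C] [EnoughProjectives C]
  {D : Type u₂} [Category.{v₂} D] [Abelian D] [HasExt.{w₂} D] [EnoughProjectives D]
  {T F : C ⥤ D} {R : D ⥤ C}
  [T.Additive] [PreservesFiniteLimits T] [PreservesFiniteColimits T]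
  [F.Additive] [PreservesFiniteLimits F] [PreservesFiniteColimits F]
  [R.Additive] [PreservesFiniteLimits R] [PreservesFiniteColimits R]

/-- If `R` retracts the exact functor `T` and has an exact left adjoint `F`, then the map
`Ext(M, N) ⟶ Ext(F M, T N)` induced by the adjoint `ε : F ⟶ T` of `𝟭 ≅ T ⋙ R` is bijective. -/
theorem bijective_app_comp_mapExactFunctor (adj : F ⊣ R) (ρ : 𝟭 C ≅ T ⋙ R) (ε : F ⟶ T)
    (hε : ∀ N, ε.app N = F.map (ρ.hom.app N) ≫ adj.counit.app (T.obj N)) (M N : C) (n : ℕ) :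
    Function.Bijective fun α : Ext.{w₁} M N n =>
      (Ext.mk₀ (ε.app M)).comp (α.mapExactFunctor T) (zero_add n) := by
  have h₁ : Function.Bijective fun α : Ext.{w₁} M N n =>
      α.comp (Ext.mk₀ (X := N) (Y := R.obj (T.obj N)) (ρ.hom.app N)) (add_zero n) := by
    refine Function.bijective_iff_has_inverse.2 ⟨fun α =>
      α.comp (Ext.mk₀ (X := R.obj (T.obj N)) (Y := N) (ρ.inv.app N)) (add_zero n),
      fun α => ?_, fun α => ?_⟩
    · dsimp only
      rw [Ext.comp_assoc_of_third_deg_zero, Ext.mk₀_comp_mk₀]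
      erw [ρ.hom_inv_id_app]
      exact Ext.comp_mk₀_id α
    · dsimp only
      rw [Ext.comp_assoc_of_third_deg_zero, Ext.mk₀_comp_mk₀]
      erw [ρ.inv_hom_id_app]
      exact Ext.comp_mk₀_id α
  -- Naturality of `ε` turns `T α` preceded by `ε` into `F α` followed by `ε`. The formula `hε` then
  -- exhibits the map as the adjunction bijection after composition with the isomorphism `N ≅ R (T
  -- N)`.
  convert (Ext.bijective_mapExactFunctor_comp_counit adj M (T.obj N) n).comp h₁ using 2 with α
  dsimp only [Function.comp]
  rw [← Ext.mapExactFunctor_naturality, hε, Ext.mapExactFunctor_comp, Ext.mapExactFunctor_mk₀,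
    Ext.comp_assoc_of_third_deg_zero, Ext.mk₀_comp_mk₀]

variable {G : C ⥤ D} [G.Additive] [PreservesFiniteLimits G] [PreservesFiniteColimits G]

/-- If `R` retracts the exact functor `T` and has an exact right adjoint `G`, then the map
`Ext(M, N) ⟶ Ext(T M, G N)` induced by the adjoint `η : T ⟶ G` of `T ⋙ R ≅ 𝟭` is bijective. -/
theorem bijective_mapExactFunctor_comp_app (adj : R ⊣ G) (ρ : 𝟭 C ≅ T ⋙ R) (η : T ⟶ G)
    (hη : ∀ M, η.app M = adj.unit.app (T.obj M) ≫ G.map (ρ.inv.app M)) (M N : C) (n : ℕ) :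
    Function.Bijective fun α : Ext.{w₁} M N n =>
      (α.mapExactFunctor T).comp (Ext.mk₀ (η.app N)) (add_zero n) := by
  have h₁ : Function.Bijective fun α : Ext.{w₁} M N n =>
      (Ext.mk₀ (X := R.obj (T.obj M)) (Y := M) (ρ.inv.app M)).comp α (zero_add n) := by
    refine Function.bijective_iff_has_inverse.2 ⟨fun α =>
      (Ext.mk₀ (X := M) (Y := R.obj (T.obj M)) (ρ.hom.app M)).comp α (zero_add n),
      fun α => ?_, fun α => ?_⟩
    · dsimp only
      rw [Ext.mk₀_comp_mk₀_assoc]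
      erw [ρ.hom_inv_id_app]
      exact Ext.mk₀_id_comp α
    · dsimp only
      rw [Ext.mk₀_comp_mk₀_assoc]
      erw [ρ.inv_hom_id_app]
      exact Ext.mk₀_id_comp α
  convert (Ext.bijective_unit_comp_mapExactFunctor adj (T.obj M) N n).comp h₁ using 2 with α
  dsimp only [Function.comp]
  rw [Ext.mapExactFunctor_naturality, hη, Ext.mapExactFunctor_comp, Ext.mapExactFunctor_mk₀,
    Ext.mk₀_comp_mk₀_assoc]

end AdjunctionComparison

/-! ### Exactness tested on underlying linear maps -/

section ExactFunctors

theorem CategoryTheory.Functor.preservesFiniteLimits_and_colimits_of_shortExact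
    {C D : Type*} [Category* C] [Category* D] [Abelian C] [Abelian D] (F : C ⥤ D) [F.Additive]
    (h : ∀ S : ShortComplex C, S.ShortExact → (S.map F).ShortExact) :
    PreservesFiniteLimits F ∧ PreservesFiniteColimits F :=
  ((Functor.exact_tfae F).out 0 3).1 h

theorem CategoryTheory.ShortComplex.shortExact_moduleCat_iff {A : Type*} [Ring A]
    (S : ShortComplex (ModuleCat.{u} A)) : S.ShortExact ↔
      Function.Injective S.f ∧ Function.Exact S.f S.g ∧ Function.Surjective S.g := by
  rw [← ShortComplex.ShortExact.moduleCat_exact_iff_function_exact, ← ModuleCat.mono_iff_injective,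
    ← ModuleCat.epi_iff_surjective]
  exact ⟨fun h => ⟨h.mono_f, h.exact, h.epi_g⟩,
    fun h => { exact := h.2.1, mono_f := h.1, epi_g := h.2.2 }⟩

/-- The equivalence with modules over the presented algebra preserves and reflects short exactness
and keeps the underlying maps, so exactness becomes a question of linear algebra. -/
theorem RLieMod.shortExact_iff {k : Type u} [Field k] {h : Type u} [LieRing h] [LieAlgebra k h]
    (S : ShortComplex (RLieMod k h)) : S.ShortExact ↔
      Function.Injective S.f.1 ∧ Function.Exact S.f.1 S.g.1 ∧ Function.Surjective S.g.1 :=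
  (ShortExact.shortExact_map_iff (S := S) (RLieMod.toModuleCat k h)).symm.trans
    (ShortComplex.shortExact_moduleCat_iff _)

theorem LeibMod.shortExact_iff {k : Type u} [Field k] {g : Type u} [NonUnitalNonAssocRing g]
    [Module k g] (S : ShortComplex (LeibMod k g)) : S.ShortExact ↔
      Function.Injective S.f.1 ∧ Function.Exact S.f.1 S.g.1 ∧ Function.Surjective S.g.1 :=
  (ShortExact.shortExact_map_iff (S := S) (LeibMod.toModuleCat k g)).symm.trans
    (ShortComplex.shortExact_moduleCat_iff _)

end ExactFunctors

/-! ### Tensor-hom adjunction over a Lie algebra, and `Ext(N, k)` -/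

namespace RLieMod

open Abelian

variable {k : Type u} [Field k] {h : Type u} [LieRing h] [LieAlgebra k h]

instance (P : RLieMod k h) : (tensorRight P).Additive where
  map_add {_ _ f f'} := Subtype.ext (LinearMap.rTensor_add (P : Type u) f.1 f'.1)

instance (P : RLieMod k h) : (tensorRight P).Linear k where
  map_smul {_ _} f t := Subtype.ext (LinearMap.rTensor_smul (P : Type u) t f.1)

instance (P : RLieMod k h) : (homFrom P).Additive where
  map_add := rfl

theorem shortExact_map_tensorRight (P : RLieMod k h) (S : ShortComplex (RLieMod k h))
    (hS : S.ShortExact) : (S.map (tensorRight P)).ShortExact := by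
  rw [shortExact_iff] at hS ⊢
  exact ⟨Module.Flat.rTensor_preserves_injective_linearMap (M := P) S.f.1 hS.1,
    rTensor_exact P hS.2.1 hS.2.2, LinearMap.rTensor_surjective P hS.2.2⟩

theorem exact_llcomp {U V W X : Type*} [AddCommGroup U] [Module k U] [AddCommGroup V] [Module k V]
    [AddCommGroup W] [Module k W] [AddCommGroup X] [Module k X] {f : V →ₗ[k] W} {f' : W →ₗ[k] X}
    (hf : Function.Injective f) (hff' : Function.Exact f f') :
    Function.Exact (LinearMap.llcomp (σ₁₂ := RingHom.id k) k U V W f)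
      (LinearMap.llcomp (σ₁₂ := RingHom.id k) k U W X f') := by
  intro φ
  refine ⟨fun hφ => ?_, ?_⟩
  -- Over a field `f` has a linear retraction `r`. As `φ` takes values in the range of `f`, the
  -- composite `r ∘ₗ φ` lifts it.
  · obtain ⟨r, hr⟩ := f.exists_leftInverse_of_injective (LinearMap.ker_eq_bot.2 hf)
    refine ⟨r ∘ₗ φ, LinearMap.ext fun p => ?_⟩
    obtain ⟨v, hv⟩ := (hff' (φ p)).1 (LinearMap.congr_fun hφ p)
    change f (r (φ p)) = φ p
    rw [← hv]
    exact congrArg f (LinearMap.congr_fun hr v)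
  · rintro ⟨ψ, rfl⟩
    exact LinearMap.ext fun p => (hff' _).2 ⟨ψ p, rfl⟩

theorem injective_llcomp {U V W : Type*} [AddCommGroup U] [Module k U] [AddCommGroup V]
    [Module k V] [AddCommGroup W] [Module k W] {f : V →ₗ[k] W} (hf : Function.Injective f) :
    Function.Injective (LinearMap.llcomp (σ₁₂ := RingHom.id k) k U V W f) :=
  fun _ _ hφψ => LinearMap.ext fun p => hf (LinearMap.congr_fun hφψ p)

theorem surjective_llcomp {U V W : Type*} [AddCommGroup U] [Module k U] [AddCommGroup V]
    [Module k V] [AddCommGroup W] [Module k W] {f : V →ₗ[k] W} (hf : Function.Surjective f) :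
    Function.Surjective (LinearMap.llcomp (σ₁₂ := RingHom.id k) k U V W f) := by
  intro φ
  obtain ⟨r, hr⟩ := f.exists_rightInverse_of_surjective (LinearMap.range_eq_top.2 hf)
  exact ⟨r ∘ₗ φ, LinearMap.ext fun p => LinearMap.congr_fun hr (φ p)⟩

theorem shortExact_map_homFrom (P : RLieMod k h) (S : ShortComplex (RLieMod k h))
    (hS : S.ShortExact) : (S.map (homFrom P)).ShortExact := by
  rw [shortExact_iff] at hS ⊢
  exact ⟨injective_llcomp hS.1, exact_llcomp hS.1 hS.2.1, surjective_llcomp hS.2.2⟩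

instance (P : RLieMod k h) : PreservesFiniteLimits (tensorRight P) :=
  ((tensorRight P).preservesFiniteLimits_and_colimits_of_shortExact
    (shortExact_map_tensorRight P)).1

instance (P : RLieMod k h) : PreservesFiniteColimits (tensorRight P) :=
  ((tensorRight P).preservesFiniteLimits_and_colimits_of_shortExact
    (shortExact_map_tensorRight P)).2

instance (P : RLieMod k h) : PreservesFiniteLimits (homFrom P) :=
  ((homFrom P).preservesFiniteLimits_and_colimits_of_shortExact (shortExact_map_homFrom P)).1

instance (P : RLieMod k h) : PreservesFiniteColimits (homFrom P) :=
  ((homFrom P).preservesFiniteLimits_and_colimits_of_shortExact (shortExact_map_homFrom P)).2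

/-- The morphism `M ⊗ P ⟶ N` corresponding to an equivariant bilinear map. -/
noncomputable def tensorDesc {M P N : RLieMod k h}
    (f : (M : Type u) →ₗ[k] (P : Type u) →ₗ[k] (N : Type u))
    (hf : ∀ m p x, f (M.act m x) p + f m (P.act p x) = N.act (f m p) x) : tensorObj M P ⟶ N :=
  ⟨TensorProduct.lift f, fun (t : (M : Type u) ⊗[k] (P : Type u)) x => by
    change TensorProduct.lift f (tensorAct M P t x) = N.act (TensorProduct.lift f t) x
    induction t using TensorProduct.induction_on with
    | zero => simp
    | add a b ha hb => simp only [map_add, LinearMap.add_apply, ha, hb]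
    | tmul m p => simp [hf]⟩

/-- Evaluation `Hom_k(P, N) ⊗ P ⟶ N`. -/
noncomputable def evalHom (P N : RLieMod k h) : tensorObj (homObj P N) P ⟶ N :=
  tensorDesc (LinearMap.id (R := k) (M := (P : Type u) →ₗ[k] (N : Type u)))
    fun (f : (P : Type u) →ₗ[k] (N : Type u)) p x =>
      sub_add_cancel (N.act (f p) x) (f (P.act p x))

/-- Coevaluation `N ⟶ Hom_k(P, N ⊗ P)`. -/
noncomputable def coevalHom (P N : RLieMod k h) : N ⟶ homObj P (tensorObj N P) :=
  ⟨TensorProduct.mk k N P, fun n x => LinearMap.ext fun p =>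
    (add_sub_cancel_right (N.act n x ⊗ₜ[k] p) (n ⊗ₜ[k] P.act p x)).symm⟩

/-- The tensor-hom adjunction for right modules over a Lie algebra. -/
noncomputable def tensorHomAdj (P : RLieMod k h) : tensorRight P ⊣ homFrom P :=
  Adjunction.mkOfUnitCounit
    { unit :=
        { app := fun N => coevalHom P N
          naturality := fun M N f => rfl }
      counit :=
        { app := fun N => evalHom P N
          naturality := fun M N f => Subtype.ext (TensorProduct.ext' fun φ p => rfl) }
      left_triangle := by
        ext N
        exact Subtype.ext (TensorProduct.ext' fun n p => rfl)
      right_triangle := by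
        ext N
        rfl }

/-- The natural transformation `N ⊗ P ⟶ N ⊗ P'` induced by `P ⟶ P'`. -/
noncomputable def tensorRightMap {P P' : RLieMod k h} (f : P ⟶ P') :
    tensorRight P ⟶ tensorRight P' where
  app N := ⟨LinearMap.lTensor (N : Type u) f.1,
    fun (t : (N : Type u) ⊗[k] (P : Type u)) x => by
    change LinearMap.lTensor (N : Type u) f.1 (tensorAct N P t x) =
      tensorAct N P' (LinearMap.lTensor (N : Type u) f.1 t) x
    induction t using TensorProduct.induction_on with
    | zero => simp
    | add a b ha hb => simp only [map_add, LinearMap.add_apply, ha, hb]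
    | tmul m p => simp [f.2 p x]⟩
  naturality M N φ := Subtype.ext (TensorProduct.ext' fun m p => rfl)

/-- The isomorphism `N ≅ k ⊗ N`. -/
noncomputable def tensorTrivIso (N : RLieMod k h) : N ≅ tensorObj (triv k h) N where
  hom := ⟨TensorProduct.mk k k N 1, fun n x =>
    ((congrArg (· + (1 : k) ⊗ₜ[k] N.act n x) (TensorProduct.zero_tmul k n)).trans
      (zero_add _)).symm⟩
  inv := tensorDesc (M := triv k h) (LinearMap.lsmul k N) fun (a : k) n x => by
    change (0 : k) • n + a • N.act n x = N.act (a • n) x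
    simp
  hom_inv_id := Subtype.ext (LinearMap.ext fun n => one_smul k n)
  inv_hom_id := Subtype.ext (TensorProduct.ext' fun (a : k) n => by
    change (1 : k) ⊗ₜ[k] (a • n) = a ⊗ₜ[k] n
    rw [TensorProduct.tmul_smul, TensorProduct.smul_tmul', smul_eq_mul, mul_one])

/-- The map `Ext(k, N^♯) ⟶ Ext(N, k)` given by tensoring with `N` and evaluating. -/
noncomputable def dualExtMap (n : ℕ) (N : RLieMod k h) :
    Ext.{u} (triv k h) (homObj N (triv k h)) n →ₗ[k] Ext.{u} N (triv k h) n :=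
  Ext.precompOfLinear (Ext.mk₀ (tensorTrivIso N).hom) k (triv k h) (zero_add n) ∘ₗ
    Ext.postcompOfLinear (Ext.mk₀ (evalHom N (triv k h))) k (tensorObj (triv k h) N)
      (add_zero n) ∘ₗ
    (tensorRight N).mapExtLinearMap k (triv k h) (homObj N (triv k h)) n

theorem dualExtMap_apply (n : ℕ) (N : RLieMod k h)
    (α : Ext.{u} (triv k h) (homObj N (triv k h)) n) :
    dualExtMap n N α = (Ext.mk₀ (tensorTrivIso N).hom).comp
      ((α.mapExactFunctor (tensorRight N)).comp (Ext.mk₀ (evalHom N (triv k h))) (add_zero n))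
      (zero_add n) := rfl

/-- The adjunction `- ⊗ N ⊣ Hom(N, -)` gives `Ext(k, N^♯) ≅ Ext(k ⊗ N, k)`, and `k ⊗ N ≅ N`. -/
theorem bijective_dualExtMap (n : ℕ) (N : RLieMod k h) :
    Function.Bijective (dualExtMap (k := k) (h := h) n N) := by
  have h₁ : Function.Bijective fun β : Ext.{u} (tensorObj (triv k h) N) (triv k h) n =>
      (Ext.mk₀ (tensorTrivIso N).hom).comp β (zero_add n) := by
    refine Function.bijective_iff_has_inverse.2 ⟨fun α =>
      (Ext.mk₀ (tensorTrivIso N).inv).comp α (zero_add n), fun α => ?_, fun α => ?_⟩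
    · dsimp only
      rw [Ext.mk₀_comp_mk₀_assoc, Iso.inv_hom_id, Ext.mk₀_id_comp]
    · dsimp only
      rw [Ext.mk₀_comp_mk₀_assoc, Iso.hom_inv_id, Ext.mk₀_id_comp]
  exact h₁.comp (Ext.bijective_mapExactFunctor_comp_counit (tensorHomAdj N) (triv k h)
    (triv k h) n)

/-- Both the functor `- ⊗ N` and the evaluation vary with `N`. The hypothesis `hφ` is dinaturality
of evaluation, and it combines with naturality of `- ⊗ N ⟶ - ⊗ N'` on the class `α`. -/
theorem dualExtMap_comp (n : ℕ) {N N' : RLieMod k h} (f : N ⟶ N')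
    (φ : homObj N' (triv k h) ⟶ homObj N (triv k h))
    (hφ : (tensorRight N).map φ ≫ evalHom N (triv k h) =
      (tensorRightMap f).app (homObj N' (triv k h)) ≫ evalHom N' (triv k h))
    (α : Ext.{u} (triv k h) (homObj N' (triv k h)) n) :
    dualExtMap n N (α.comp (Ext.mk₀ φ) (add_zero n)) =
      (Ext.mk₀ f).comp (dualExtMap n N' α) (zero_add n) := by
  have h₁ : (tensorTrivIso N).hom ≫ (tensorRightMap f).app (triv k h) =
      f ≫ (tensorTrivIso N').hom := rfl
  have h₃ : ((α.mapExactFunctor (tensorRight N)).comp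
      (Ext.mk₀ ((tensorRight N).map φ)) (add_zero n)).comp
        (Ext.mk₀ (evalHom N (triv k h))) (add_zero n) =
      (Ext.mk₀ ((tensorRightMap f).app (triv k h))).comp
        ((α.mapExactFunctor (tensorRight N')).comp (Ext.mk₀ (evalHom N' (triv k h)))
          (add_zero n)) (zero_add n) := by
    have h₄ : (Ext.mk₀ ((tensorRight N).map φ)).comp
        (Ext.mk₀ (evalHom N (triv k h))) (zero_add 0) =
        (Ext.mk₀ ((tensorRightMap f).app (homObj N' (triv k h)))).comp
          (Ext.mk₀ (evalHom N' (triv k h))) (zero_add 0) :=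
      (Ext.mk₀_comp_mk₀ _ _).trans ((congrArg Ext.mk₀ hφ).trans (Ext.mk₀_comp_mk₀ _ _).symm)
    rw [Ext.comp_assoc_of_third_deg_zero]
    refine (congrArg (fun z => Ext.comp (α.mapExactFunctor (tensorRight N)) z
      (add_zero n)) h₄).trans ?_
    refine (Ext.comp_assoc_of_third_deg_zero _ _ _ _).symm.trans ?_
    refine (congrArg (fun z => Ext.comp z (Ext.mk₀ (evalHom N' (triv k h))) (add_zero n))
      (Ext.mapExactFunctor_naturality (tensorRightMap f) α)).trans ?_
    exact Ext.comp_assoc_of_third_deg_zero _ _ _ _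
  rw [dualExtMap_apply, dualExtMap_apply, Ext.mapExactFunctor_comp, Ext.mapExactFunctor_mk₀]
  refine (congrArg (fun z => Ext.comp (Ext.mk₀ (tensorTrivIso N).hom) z (zero_add n)) h₃).trans ?_
  refine (Ext.mk₀_comp_mk₀_assoc _ _ _).trans ?_
  rw [h₁]
  exact (Ext.mk₀_comp_mk₀_assoc _ _ _).symm

variable (k h) in
/-- `Ext^n(N, k) ≅ H^n(h; N^♯)`, naturally in `N`. -/
theorem nonempty_extTo_triv_iso (n : ℤ) :
    Nonempty (extTo k (triv k h) n ≅ dual k h ⋙ lieCohomology k h n) := by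
  match n with
  | Int.ofNat n =>
    let Φ : dual k h ⋙ lieCohomology k h (Int.ofNat n) ⟶ extTo k (triv k h) (Int.ofNat n) :=
      { app := fun N => ModuleCat.ofHom (dualExtMap n N.unop)
        naturality := fun N N' f => by
          ext α
          exact dualExtMap_comp n f.unop ((dual k h).map f)
            (Subtype.ext (TensorProduct.ext' fun φ p => rfl)) α }
    have : IsIso Φ := by
      rw [NatTrans.isIso_iff_isIso_app]
      intro N
      rw [ConcreteCategory.isIso_iff_bijective]
      exact bijective_dualExtMap n N.unop
    exact ⟨(asIso Φ).symm⟩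
  | Int.negSucc n => exact ⟨Iso.refl _⟩

end RLieMod

/-! ### Restriction, induction, and the sequence ending in `N^s` -/

namespace LeibMod

open Abelian

variable (k : Type u) [Field k] (g : Type u) [NonUnitalNonAssocRing g] [Module k g]
  [IsScalarTower k g g] [SMulCommClass k g g] [IsRightLeibniz g]

instance : (symF k g).Additive where
  map_add := rfl

instance : (symF k g).Linear k where
  map_smul _ _ := rfl

instance : (asymF k g).Additive where
  map_add := rfl

instance : (asymF k g).Linear k where
  map_smul _ _ := rfl

/-- Restriction to the right action, as a functor. -/
noncomputable def restrictF : LeibMod k g ⥤ RLieMod k (LieQuot k g) where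
  obj M := restrict M
  map {M N} f := ⟨f.1, fun m x => by
    obtain ⟨x, rfl⟩ := LieQuot.mk_surjective k g x
    exact f.2.2 m x⟩

instance : (restrictF k g).Additive where
  map_add := rfl

theorem shortExact_map_symF (S : ShortComplex (RLieMod k (LieQuot k g))) (hS : S.ShortExact) :
    (S.map (symF k g)).ShortExact :=
  (shortExact_iff _).2 ((RLieMod.shortExact_iff S).1 hS)

theorem shortExact_map_asymF (S : ShortComplex (RLieMod k (LieQuot k g))) (hS : S.ShortExact) :
    (S.map (asymF k g)).ShortExact :=
  (shortExact_iff _).2 ((RLieMod.shortExact_iff S).1 hS)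

theorem shortExact_map_restrictF (S : ShortComplex (LeibMod k g)) (hS : S.ShortExact) :
    (S.map (restrictF k g)).ShortExact :=
  (RLieMod.shortExact_iff _).2 ((shortExact_iff S).1 hS)

instance : PreservesFiniteLimits (symF k g) :=
  ((symF k g).preservesFiniteLimits_and_colimits_of_shortExact (shortExact_map_symF k g)).1

instance : PreservesFiniteColimits (symF k g) :=
  ((symF k g).preservesFiniteLimits_and_colimits_of_shortExact (shortExact_map_symF k g)).2

instance : PreservesFiniteLimits (asymF k g) :=
  ((asymF k g).preservesFiniteLimits_and_colimits_of_shortExact (shortExact_map_asymF k g)).1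

instance : PreservesFiniteColimits (asymF k g) :=
  ((asymF k g).preservesFiniteLimits_and_colimits_of_shortExact (shortExact_map_asymF k g)).2

instance : PreservesFiniteLimits (restrictF k g) :=
  ((restrictF k g).preservesFiniteLimits_and_colimits_of_shortExact
    (shortExact_map_restrictF k g)).1

instance : PreservesFiniteColimits (restrictF k g) :=
  ((restrictF k g).preservesFiniteLimits_and_colimits_of_shortExact
    (shortExact_map_restrictF k g)).2

/-- The left action on `k^s` is `-0`, which equals the zero action but not definitionally; all other
data agree on the nose. -/
theorem symF_obj_triv : (symF k g).obj (RLieMod.triv k (LieQuot k g)) = triv k g := by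
  have h : -((0 : k →ₗ[k] LieQuot k g →ₗ[k] k).compl₂ (LieQuot.mk k g)).flip = 0 := by
    ext x
    exact neg_zero
  unfold triv
  exact (mk.injEq ..).mpr ⟨rfl, HEq.rfl, HEq.rfl, heq_of_eq h, HEq.rfl⟩

/-- Restricting a symmetric module gives back the original module. -/
noncomputable def symRestrictIso : 𝟭 (RLieMod k (LieQuot k g)) ≅ symF k g ⋙ restrictF k g where
  hom := { app := fun N => ⟨LinearMap.id, fun n x => by
            obtain ⟨x, rfl⟩ := LieQuot.mk_surjective k g x
            rfl⟩
           naturality := fun _ _ _ => rfl }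
  inv := { app := fun N => ⟨LinearMap.id, fun n x => by
            obtain ⟨x, rfl⟩ := LieQuot.mk_surjective k g x
            rfl⟩
           naturality := fun _ _ _ => rfl }
  hom_inv_id := rfl
  inv_hom_id := rfl

/-- Restricting an antisymmetric module gives back the original module. -/
noncomputable def asymRestrictIso : 𝟭 (RLieMod k (LieQuot k g)) ≅ asymF k g ⋙ restrictF k g where
  hom := { app := fun N => ⟨LinearMap.id, fun n x => by
            obtain ⟨x, rfl⟩ := LieQuot.mk_surjective k g x
            rfl⟩
           naturality := fun _ _ _ => rfl }
  inv := { app := fun N => ⟨LinearMap.id, fun n x => by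
            obtain ⟨x, rfl⟩ := LieQuot.mk_surjective k g x
            rfl⟩
           naturality := fun _ _ _ => rfl }
  hom_inv_id := rfl
  inv_hom_id := rfl

variable {k g}

section Free

variable (N : RLieMod k (LieQuot k g))

/-- The action of `g` on a right `g_Lie`-module, as an equivariant map `N ⊗ g^↓ ⟶ N`. -/
noncomputable def contract : RLieMod.tensorObj N (adjointRestrict k g) ⟶ N :=
  RLieMod.tensorDesc (P := adjointRestrict k g) (N.act.compl₂ (LieQuot.mk k g))
    fun n (x : g) y => by
      obtain ⟨y, rfl⟩ := LieQuot.mk_surjective k g y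
      change N.act (N.act n (LieQuot.mk k g y)) (LieQuot.mk k g x) +
        N.act n (LieQuot.mk k g (x * y)) = N.act (N.act n (LieQuot.mk k g x)) (LieQuot.mk k g y)
      rw [← LieQuot.mk_bracket, N.act_lie]
      abel

/-- `N ⊗ g`, the underlying space of the module generated by the elements `x n`. -/
abbrev TensorAdj : Type u := (N : Type u) ⊗[k] (adjointRestrict k g : Type u)

/-- The right action on `N ⊗ g`. -/
noncomputable abbrev tensorAdjAct : TensorAdj N →ₗ[k] g →ₗ[k] TensorAdj N :=
  (RLieMod.tensorAct N (adjointRestrict k g)).compl₂ (LieQuot.mk k g)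

/-- The contraction, as a linear map. -/
noncomputable abbrev contractL : TensorAdj N →ₗ[k] (N : Type u) := (contract N).1

theorem contractL_act (t : TensorAdj N) (y : g) :
    contractL N (tensorAdjAct N t y) = N.act (contractL N t) (LieQuot.mk k g y) :=
  (contract N).2 t _

/-- Pure tensors. -/
noncomputable abbrev tmulAdj : (N : Type u) →ₗ[k] g →ₗ[k] TensorAdj N :=
  TensorProduct.mk k (N : Type u) (adjointRestrict k g : Type u)

theorem contractL_tmulAdj (n : N) (x : g) :
    contractL N (tmulAdj N n x) = N.act n (LieQuot.mk k g x) := rfl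

theorem tensorAdjAct_tmulAdj (n : N) (x y : g) : tensorAdjAct N (tmulAdj N n x) y =
    tmulAdj N (N.act n (LieQuot.mk k g y)) x + tmulAdj N n (x * y) := rfl

theorem tensorAdjAct_mul (t : TensorAdj N) (x y : g) : tensorAdjAct N t (x * y) =
    tensorAdjAct N (tensorAdjAct N t x) y - tensorAdjAct N (tensorAdjAct N t y) x :=
  (RLieMod.tensorObj N (adjointRestrict k g)).act_lie t (LieQuot.mk k g x) (LieQuot.mk k g y)

theorem act_mk_mul (n : N) (x y : g) : N.act n (LieQuot.mk k g (x * y)) =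
    N.act (N.act n (LieQuot.mk k g x)) (LieQuot.mk k g y) -
      N.act (N.act n (LieQuot.mk k g y)) (LieQuot.mk k g x) :=
  N.act_lie n (LieQuot.mk k g x) (LieQuot.mk k g y)

/-- The induced `g`-module `N ⊕ (N ⊗ g)`, where `n ⊗ x` stands for `x n`. -/
noncomputable def freeObj : LeibMod k g where
  carrier := N.carrier × TensorAdj N
  -- Relations (LML) and (LLM) force `x (y n) = - x (n y)`. A tensor `t`, standing for a sum of
  -- elements `y n`, must therefore be acted on from the left like minus its contraction.
  left := LinearMap.mk₂ k (fun x p => (0, tmulAdj N (p.1 - contractL N p.2) x))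
    (fun x y p => by rw [map_add, Prod.mk_add_mk, add_zero])
    (fun t x p => by rw [map_smul, Prod.smul_mk, smul_zero])
    (fun x p q => by
      refine Prod.ext (add_zero (0 : N)).symm ?_
      change tmulAdj N ((p.1 + q.1) - contractL N (p.2 + q.2)) x =
        tmulAdj N (p.1 - contractL N p.2) x + tmulAdj N (q.1 - contractL N q.2) x
      rw [map_add, add_sub_add_comm, map_add, LinearMap.add_apply])
    (fun t x p => by
      refine Prod.ext (smul_zero t).symm ?_
      change tmulAdj N (t • p.1 - contractL N (t • p.2)) x =
        t • tmulAdj N (p.1 - contractL N p.2) x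
      rw [map_smul, ← smul_sub, map_smul, LinearMap.smul_apply])
  right := LinearMap.mk₂ k (fun p y => (N.act p.1 (LieQuot.mk k g y), tensorAdjAct N p.2 y))
    (fun p q y => by
      rw [Prod.fst_add, Prod.snd_add, map_add, map_add, LinearMap.add_apply, LinearMap.add_apply,
        Prod.mk_add_mk])
    (fun t p y => by
      rw [Prod.smul_fst, Prod.smul_snd, map_smul, map_smul, LinearMap.smul_apply,
        LinearMap.smul_apply, Prod.smul_mk])
    (fun p x y => by rw [map_add, map_add, map_add, Prod.mk_add_mk])
    (fun t p y => by rw [map_smul, map_smul, map_smul, Prod.smul_mk])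
  mll p x y := Prod.ext (act_mk_mul N p.1 x y) (tensorAdjAct_mul N p.2 x y)
  lml x p y := by
    refine Prod.ext ?_ ?_
    · change (0 : N) = N.act 0 (LieQuot.mk k g y) - 0
      simp
    · change tmulAdj N (N.act p.1 (LieQuot.mk k g y) - contractL N (tensorAdjAct N p.2 y)) x =
        tensorAdjAct N (tmulAdj N (p.1 - contractL N p.2) x) y -
          tmulAdj N (p.1 - contractL N p.2) (x * y)
      rw [contractL_act, tensorAdjAct_tmulAdj, add_sub_cancel_right, map_sub N.act,
        LinearMap.sub_apply]
  llm x y p := by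
    refine Prod.ext ?_ ?_
    · change (0 : N) = 0 - N.act 0 (LieQuot.mk k g y)
      simp
    · change tmulAdj N (0 - contractL N (tmulAdj N (p.1 - contractL N p.2) y)) x =
        tmulAdj N (p.1 - contractL N p.2) (x * y) -
          tensorAdjAct N (tmulAdj N (p.1 - contractL N p.2) x) y
      rw [contractL_tmulAdj, tensorAdjAct_tmulAdj, zero_sub, map_neg, LinearMap.neg_apply]
      abel

variable {N} in
theorem contractL_rTensor {N' : RLieMod k (LieQuot k g)} (f : N ⟶ N') (t : TensorAdj N) :
    contractL N' (LinearMap.rTensor (adjointRestrict k g : Type u) f.1 t) =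
      f.1 (contractL N t) := by
  induction t using TensorProduct.induction_on with
  | zero => simp only [map_zero]
  | add a b ha hb => simp only [map_add, ha, hb]
  | tmul n x => exact (f.2 n _).symm

end Free

variable (k g) in
/-- The functor `N ↦ N ⊕ (N ⊗ g)`, left adjoint to restriction. -/
noncomputable def freeF : RLieMod k (LieQuot k g) ⥤ LeibMod k g where
  obj N := freeObj N
  map {N N'} f := ⟨f.1.prodMap (LinearMap.rTensor (adjointRestrict k g : Type u) f.1),
    fun x (p : N.carrier × TensorAdj N) => by
      refine Prod.ext (map_zero f.1) ?_
      change tmulAdj N' (f.1 (p.1 - contractL N p.2)) x = tmulAdj N' (f.1 p.1 - contractL N'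
        (LinearMap.rTensor (adjointRestrict k g : Type u) f.1 p.2)) x
      rw [contractL_rTensor, map_sub],
    fun (p : N.carrier × TensorAdj N) x =>
      Prod.ext (f.2 p.1 _) (RLieMod.rTensor_tensorAct (adjointRestrict k g) f p.2 _)⟩
  map_id N := Subtype.ext (LinearMap.prod_ext rfl (TensorProduct.ext' fun n x => rfl))
  map_comp f f' := Subtype.ext (LinearMap.prod_ext rfl (TensorProduct.ext' fun n x => rfl))

instance : (freeF k g).Additive where
  map_add {N N' f f'} := Subtype.ext <| by
    change (f.1 + f'.1).prodMap (LinearMap.rTensor (adjointRestrict k g : Type u) (f.1 + f'.1)) =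
      f.1.prodMap (LinearMap.rTensor (adjointRestrict k g : Type u) f.1) +
        f'.1.prodMap (LinearMap.rTensor (adjointRestrict k g : Type u) f'.1)
    rw [LinearMap.rTensor_add]
    exact LinearMap.ext fun p => rfl

theorem exact_prodMap {A B C A' B' C' : Type*} [Zero C] [Zero C'] {f : A → B}
    {e : B → C} {f' : A' → B'} {e' : B' → C'} (h : Function.Exact f e) (h' : Function.Exact f' e') :
    Function.Exact (Prod.map f f') (Prod.map e e') := by
  rintro ⟨b, b'⟩
  rw [Set.range_prodMap, Set.mem_prod, ← h b, ← h' b', Prod.map_apply, Prod.mk_eq_zero]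

variable (k g) in
theorem shortExact_map_freeF (S : ShortComplex (RLieMod k (LieQuot k g))) (hS : S.ShortExact) :
    (S.map (freeF k g)).ShortExact := by
  have h := (RLieMod.shortExact_iff S).1 hS
  have h' := (RLieMod.shortExact_iff _).1
    (RLieMod.shortExact_map_tensorRight (adjointRestrict k g) S hS)
  exact (shortExact_iff _).2 ⟨h.1.prodMap h'.1, exact_prodMap h.2.1 h'.2.1, h.2.2.prodMap h'.2.2⟩

instance : PreservesFiniteLimits (freeF k g) :=
  ((freeF k g).preservesFiniteLimits_and_colimits_of_shortExact (shortExact_map_freeF k g)).1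

instance : PreservesFiniteColimits (freeF k g) :=
  ((freeF k g).preservesFiniteLimits_and_colimits_of_shortExact (shortExact_map_freeF k g)).2

/-- The left action of `g` on `M`, as a linear map `M ⊗ g ⟶ M`. -/
noncomputable def leftTensor (M : LeibMod k g) : (M : Type u) ⊗[k] g →ₗ[k] (M : Type u) :=
  TensorProduct.lift M.left.flip

/-- The right action of `g` on `M`, as a linear map `M ⊗ g ⟶ M`. -/
noncomputable def rightTensor (M : LeibMod k g) : (M : Type u) ⊗[k] g →ₗ[k] (M : Type u) :=
  contractL (restrict M)

/-- The sum of (LML) and (LLM) is `y (x m) + y (m x) = 0`. This is what makes the counit compatible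
with the left action. -/
theorem left_leftTensor (M : LeibMod k g) (t : (M : Type u) ⊗[k] g) (y : g) :
    M.left y (leftTensor M t) = - M.left y (rightTensor M t) := by
  have : M.left y ∘ₗ leftTensor M = -(M.left y ∘ₗ rightTensor M) :=
    TensorProduct.ext' fun m x => by
      change M.left y (M.left x m) = -M.left y (M.right m x)
      rw [M.llm, M.lml, neg_sub]
  exact LinearMap.congr_fun this t

/-- A rearrangement of (LML): the map `m ⊗ x ↦ x m` respects the right actions. -/
theorem leftTensor_act (M : LeibMod k g) (t : (M : Type u) ⊗[k] g) (y : g) :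
    leftTensor M (tensorAdjAct (restrict M) t y) = M.right (leftTensor M t) y := by
  have : leftTensor M ∘ₗ (tensorAdjAct (restrict M)).flip y = M.right.flip y ∘ₗ leftTensor M :=
    TensorProduct.ext' fun (m : M) (x : g) => by
      refine (map_add (leftTensor M) (M.right m y ⊗ₜ[k] x) (m ⊗ₜ[k] (x * y))).trans ?_
      change M.left x (M.right m y) + M.left (x * y) m = M.right (M.left x m) y
      rw [M.lml, sub_add_cancel]
  exact LinearMap.congr_fun this t

/-- The counit `(m, m' ⊗ x) ↦ m + x m'` of the induction-restriction adjunction. -/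
noncomputable def freeCounit (M : LeibMod k g) : freeObj (restrict M) ⟶ M :=
  ⟨LinearMap.coprod (M := (M : Type u)) (M₂ := (M : Type u) ⊗[k] g) LinearMap.id (leftTensor M),
    fun y (p : M.carrier × ((M : Type u) ⊗[k] g)) => by
      have h : (0 : M) + M.left y (p.1 - rightTensor M p.2) =
          M.left y (p.1 + leftTensor M p.2) := by
        rw [map_add, left_leftTensor, zero_add, map_sub, sub_eq_add_neg]
      exact h,
    fun (p : M.carrier × ((M : Type u) ⊗[k] g)) y => by
      change M.right p.1 y + leftTensor M (tensorAdjAct (restrict M) p.2 y) =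
        M.right (p.1 + leftTensor M p.2) y
      rw [leftTensor_act, map_add, LinearMap.add_apply]⟩

/-- The unit `n ↦ (n, 0)` of the induction-restriction adjunction. -/
noncomputable def freeUnit (N : RLieMod k (LieQuot k g)) : N ⟶ restrict (freeObj N) :=
  ⟨LinearMap.inl k (N : Type u) (TensorAdj N), fun n x => by
    obtain ⟨x, rfl⟩ := LieQuot.mk_surjective k g x
    exact Prod.ext rfl (by
      change (0 : TensorAdj N) = tensorAdjAct N 0 x
      rw [map_zero, LinearMap.zero_apply])⟩

variable (k g) in
/-- Induction is left adjoint to restriction. -/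
noncomputable def freeAdj : freeF k g ⊣ restrictF k g :=
  Adjunction.mkOfUnitCounit
    { unit :=
        { app := fun N => freeUnit N
          naturality := fun N N' f => Subtype.ext (LinearMap.ext fun n =>
            Prod.ext rfl (map_zero (LinearMap.rTensor (adjointRestrict k g : Type u) f.1)).symm) }
      counit :=
        { app := fun M => freeCounit M
          naturality := fun M M' f => Subtype.ext (LinearMap.prod_ext
            (LinearMap.ext fun (m : M) => by
              change f.1 m + leftTensor M' (LinearMap.rTensor g f.1 0) = f.1 (m + leftTensor M 0)
              rw [map_zero, map_zero, map_zero, add_zero, add_zero])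
            (TensorProduct.ext' fun (m : M) (x : g) => by
              change f.1 0 + M'.left x (f.1 m) = f.1 (0 + M.left x m)
              rw [map_zero, zero_add, zero_add]
              exact (f.2.1 x m).symm)) }
      left_triangle := by
        ext N
        refine Subtype.ext (LinearMap.prod_ext (LinearMap.ext fun (n : N) => ?_)
          (TensorProduct.ext' fun (n : N) (x : g) => ?_))
        · exact (congrArg (fun z : N.carrier × TensorAdj N => ((n, 0) : N.carrier × TensorAdj N) + z)
            (map_zero (leftTensor (freeObj N)))).trans (add_zero _)
        · refine Prod.ext (add_zero (0 : N)) ?_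
          change (0 : TensorAdj N) + tmulAdj N (n - contractL N 0) x = tmulAdj N n x
          rw [map_zero, sub_zero, zero_add]
      right_triangle := by
        ext M
        refine Subtype.ext (LinearMap.ext fun (m : M) => ?_)
        change m + leftTensor M 0 = m
        simp }

/-- `N ⊗ g ⟶ N ⊕ (N ⊗ g)`, `n ⊗ x ↦ n x + x n`. -/
noncomputable def asymToFree :
    RLieMod.tensorRight (adjointRestrict k g) ⋙ asymF k g ⟶ freeF k g where
  app N := ⟨LinearMap.prod (contractL N) LinearMap.id,
    fun x (t : TensorAdj N) => by
      -- The left action on `(n, t)` depends only on `n` minus the contraction of `t`, which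
      -- vanishes on the image; hence the image is antisymmetric.
      change ((contractL N) 0, (0 : TensorAdj N)) =
        ((0, tmulAdj N (contractL N t - contractL N t) x) : N.carrier × TensorAdj N)
      rw [sub_self, map_zero, map_zero, LinearMap.zero_apply],
    fun (t : TensorAdj N) x => Prod.ext (contractL_act N t x) rfl⟩
  naturality N N' f := Subtype.ext (LinearMap.ext fun (t : TensorAdj N) =>
    Prod.ext (contractL_rTensor f t) rfl)

/-- `N ⊕ (N ⊗ g) ⟶ N^s`, `(n, n' ⊗ x) ↦ n - n' x`. -/
noncomputable def freeToSym : freeF k g ⟶ symF k g where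
  app N := ⟨LinearMap.coprod LinearMap.id (-contractL N),
    fun x (p : N.carrier × TensorAdj N) => by
      change (0 : N) + -contractL N (tmulAdj N (p.1 - contractL N p.2) x) =
        -N.act (p.1 + -contractL N p.2) (LieQuot.mk k g x)
      rw [contractL_tmulAdj, zero_add, sub_eq_add_neg],
    fun (p : N.carrier × TensorAdj N) x => by
      change N.act p.1 (LieQuot.mk k g x) + -contractL N (tensorAdjAct N p.2 x) =
        N.act (p.1 + -contractL N p.2) (LieQuot.mk k g x)
      rw [contractL_act, map_add, map_neg, LinearMap.add_apply, LinearMap.neg_apply]⟩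
  naturality N N' f := Subtype.ext (LinearMap.ext fun (p : N.carrier × TensorAdj N) => by
    change f.1 p.1 + -contractL N' (LinearMap.rTensor _ f.1 p.2) = f.1 (p.1 + -contractL N p.2)
    rw [contractL_rTensor, map_add, map_neg])

theorem asymToFree_comp_freeToSym (N : RLieMod k (LieQuot k g)) :
    (asymToFree (k := k) (g := g)).app N ≫ freeToSym.app N = 0 :=
  Subtype.ext (LinearMap.ext fun (t : TensorAdj N) => add_neg_cancel (contractL N t))

/-- The kernel of `(n, t) ↦ n - contractL N t` is the graph of the contraction, which is the image
of `N ⊗ g`. -/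
theorem shortExact_asymToFree_freeToSym (N : RLieMod k (LieQuot k g)) :
    (ShortComplex.mk _ _ (asymToFree_comp_freeToSym N)).ShortExact := by
  refine (shortExact_iff _).2 ⟨fun (t t' : TensorAdj N) h => (Prod.ext_iff.1 h).2,
    fun (p : N.carrier × TensorAdj N) => ⟨fun h => ?_, ?_⟩, fun (n : N) => ⟨(n, 0), ?_⟩⟩
  · exact ⟨p.2, Prod.ext (add_neg_eq_zero.1 h).symm rfl⟩
  · rintro ⟨t, rfl⟩
    exact add_neg_cancel (contractL N t)
  · change n + -contractL N 0 = n
    simp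

/-- The counit at `N^s` sends `n ⊗ x` to `x n = - n x`, so `freeToSym` is the adjoint of `N ≅
R(N^s)`, as the comparison theorem requires. -/
theorem freeToSym_app (N : RLieMod k (LieQuot k g)) : freeToSym.app N =
    (freeF k g).map ((symRestrictIso k g).hom.app N) ≫
      (freeAdj k g).counit.app ((symF k g).obj N) :=
  Subtype.ext (LinearMap.prod_ext
    (LinearMap.ext fun (n : N) => by
      refine congrArg (fun z : N => n + z) ?_
      exact (neg_eq_zero.2 (map_zero (contractL N))).trans
        (map_zero (leftTensor ((symF k g).obj N))).symm)
    (TensorProduct.ext' fun (n : N) (x : g) => rfl))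

end LeibMod

/-! ### Coinduction, and the sequence starting with `N^a` -/

namespace LeibMod

open Abelian

variable {k : Type u} [Field k] {g : Type u} [NonUnitalNonAssocRing g] [Module k g]
  [IsScalarTower k g g] [SMulCommClass k g g] [IsRightLeibniz g]

section Cofree

variable (N : RLieMod k (LieQuot k g))

/-- The right action `(f y)(x) = f(x) y - f(x y)` of `g` on `Hom_k(g, N)`. -/
noncomputable def homAdjAct : (g →ₗ[k] N) →ₗ[k] g →ₗ[k] (g →ₗ[k] N) :=
  (RLieMod.homAct (adjointRestrict k g) N).compl₂ (LieQuot.mk k g)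

theorem homAdjAct_apply (f : g →ₗ[k] N) (y x : g) :
    homAdjAct N f y x = N.act (f x) (LieQuot.mk k g y) - f (x * y) := rfl

theorem homAdjAct_mul (f : g →ₗ[k] N) (x y : g) : homAdjAct N f (x * y) =
    homAdjAct N (homAdjAct N f x) y - homAdjAct N (homAdjAct N f y) x :=
  (RLieMod.homObj (adjointRestrict k g) N).act_lie f (LieQuot.mk k g x) (LieQuot.mk k g y)

/-- The coinduced `g`-module `N ⊕ Hom_k(g, N)`. -/
noncomputable def cofreeObj : LeibMod k g where
  carrier := N.carrier × (g →ₗ[k] N)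
  -- The function `f` in `(n, f)` records `x ↦ x m` for an element `m`. Then `y m` has first
  -- component `f y`, and `x (y m) = - x (m y)` makes its function minus the right translate of `f`.
  left := LinearMap.mk₂ k (fun y p => (p.2 y, -homAdjAct N p.2 y))
    (fun x y p => by rw [map_add, map_add, neg_add, Prod.mk_add_mk])
    (fun t x p => by rw [map_smul, map_smul, ← smul_neg, Prod.smul_mk])
    (fun x p q => by
      rw [Prod.snd_add, map_add, LinearMap.add_apply, LinearMap.add_apply, neg_add,
        Prod.mk_add_mk])
    (fun t x p => by
      rw [Prod.smul_snd, map_smul, LinearMap.smul_apply, LinearMap.smul_apply, ← smul_neg,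
        Prod.smul_mk])
  right := LinearMap.mk₂ k (fun p y => (N.act p.1 (LieQuot.mk k g y), homAdjAct N p.2 y))
    (fun p q y => by
      rw [Prod.fst_add, Prod.snd_add, map_add, map_add, LinearMap.add_apply, LinearMap.add_apply,
        Prod.mk_add_mk])
    (fun t p y => by
      rw [Prod.smul_fst, Prod.smul_snd, map_smul, map_smul, LinearMap.smul_apply,
        LinearMap.smul_apply, Prod.smul_mk])
    (fun p x y => by rw [map_add, map_add, map_add, Prod.mk_add_mk])
    (fun t p y => by rw [map_smul, map_smul, map_smul, Prod.smul_mk])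
  mll p x y := Prod.ext (act_mk_mul N p.1 x y) (homAdjAct_mul N p.2 x y)
  lml x p y := by
    refine Prod.ext (sub_eq_sub_iff_add_eq_add.2 rfl) ?_
    change -homAdjAct N (homAdjAct N p.2 y) x =
      homAdjAct N (-homAdjAct N p.2 x) y - -homAdjAct N p.2 (x * y)
    rw [homAdjAct_mul, map_neg, LinearMap.neg_apply]
    abel
  llm x y p := by
    refine Prod.ext ?_ ?_
    · change -homAdjAct N p.2 y x = p.2 (x * y) - N.act (p.2 x) (LieQuot.mk k g y)
      rw [homAdjAct_apply, neg_sub]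
    · change -homAdjAct N (-homAdjAct N p.2 y) x =
        -homAdjAct N p.2 (x * y) - homAdjAct N (-homAdjAct N p.2 x) y
      rw [homAdjAct_mul, map_neg, map_neg, LinearMap.neg_apply, LinearMap.neg_apply]
      abel

variable {N} in
theorem homAdjAct_comp {N' : RLieMod k (LieQuot k g)} (f : N ⟶ N') (φ : g →ₗ[k] N) (y : g) :
    homAdjAct N' (f.1 ∘ₗ φ) y = f.1 ∘ₗ homAdjAct N φ y :=
  LinearMap.ext fun x => by
    rw [homAdjAct_apply, LinearMap.comp_apply, LinearMap.comp_apply, LinearMap.comp_apply,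
      homAdjAct_apply, map_sub, f.2]

end Cofree

variable (k g) in
/-- The functor `N ↦ N ⊕ Hom_k(g, N)`, right adjoint to restriction. -/
noncomputable def cofreeF : RLieMod k (LieQuot k g) ⥤ LeibMod k g where
  obj N := cofreeObj N
  map {N N'} f := ⟨f.1.prodMap (LinearMap.llcomp k g N N' f.1),
    fun y (p : N.carrier × (g →ₗ[k] N)) => by
      refine Prod.ext rfl ?_
      change f.1 ∘ₗ (-homAdjAct N p.2 y) = -homAdjAct N' (f.1 ∘ₗ p.2) y
      rw [homAdjAct_comp, LinearMap.comp_neg],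
    fun (p : N.carrier × (g →ₗ[k] N)) y =>
      Prod.ext (f.2 p.1 _) (homAdjAct_comp f p.2 y).symm⟩
  map_id N := rfl
  map_comp f f' := rfl

instance : (cofreeF k g).Additive where
  map_add := rfl

variable (k g) in
theorem shortExact_map_cofreeF (S : ShortComplex (RLieMod k (LieQuot k g))) (hS : S.ShortExact) :
    (S.map (cofreeF k g)).ShortExact := by
  have h := (RLieMod.shortExact_iff S).1 hS
  have h' := (RLieMod.shortExact_iff _).1
    (RLieMod.shortExact_map_homFrom (adjointRestrict k g) S hS)
  exact (shortExact_iff _).2 ⟨h.1.prodMap h'.1, exact_prodMap h.2.1 h'.2.1, h.2.2.prodMap h'.2.2⟩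

instance : PreservesFiniteLimits (cofreeF k g) :=
  ((cofreeF k g).preservesFiniteLimits_and_colimits_of_shortExact (shortExact_map_cofreeF k g)).1

instance : PreservesFiniteColimits (cofreeF k g) :=
  ((cofreeF k g).preservesFiniteLimits_and_colimits_of_shortExact (shortExact_map_cofreeF k g)).2

/-- The unit `m ↦ (m, x ↦ x m)` of the restriction-coinduction adjunction. -/
noncomputable def cofreeUnit (M : LeibMod k g) : M ⟶ cofreeObj (restrict M) :=
  ⟨LinearMap.prod (M₂ := (M : Type u)) (M₃ := g →ₗ[k] M) LinearMap.id M.left.flip,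
    fun y m => Prod.ext rfl (LinearMap.ext fun x => by
      change M.left x (M.left y m) = -(M.right (M.left x m) y - M.left (x * y) m)
      rw [M.llm, neg_sub]),
    fun m y => Prod.ext rfl (LinearMap.ext fun x => M.lml x m y)⟩

/-- The counit `(n, f) ↦ n` of the restriction-coinduction adjunction. -/
noncomputable def cofreeCounit (N : RLieMod k (LieQuot k g)) : restrict (cofreeObj N) ⟶ N :=
  ⟨LinearMap.fst k N.carrier (g →ₗ[k] N), fun p x => by
    obtain ⟨x, rfl⟩ := LieQuot.mk_surjective k g x
    rfl⟩

variable (k g) in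
/-- Coinduction is right adjoint to restriction. -/
noncomputable def cofreeAdj : restrictF k g ⊣ cofreeF k g :=
  Adjunction.mkOfUnitCounit
    { unit :=
        { app := fun M => cofreeUnit M
          naturality := fun M M' f => Subtype.ext (LinearMap.ext fun (m : M) =>
            Prod.ext rfl (LinearMap.ext fun x => (f.2.1 x m).symm)) }
      counit :=
        { app := fun N => cofreeCounit N
          naturality := fun N N' f => rfl }
      left_triangle := by
        ext M
        rfl
      right_triangle := by
        ext N
        rfl }

/-- The inclusion `N^a ⟶ N ⊕ Hom_k(g, N)`. -/
noncomputable def asymToCofree : asymF k g ⟶ cofreeF k g where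
  app N := ⟨LinearMap.inl k N.carrier (g →ₗ[k] N),
    fun y n => Prod.ext rfl (by
      change (0 : g →ₗ[k] N) = -homAdjAct N 0 y
      rw [map_zero, LinearMap.zero_apply, neg_zero]),
    fun n y => Prod.ext rfl (by
      change (0 : g →ₗ[k] N) = homAdjAct N 0 y
      rw [map_zero, LinearMap.zero_apply])⟩
  naturality N N' f := Subtype.ext (LinearMap.ext fun (n : N) =>
    Prod.ext rfl (LinearMap.comp_zero f.1).symm)

/-- The projection `N ⊕ Hom_k(g, N) ⟶ Hom_k(g, N)^s`. -/
noncomputable def cofreeToSym :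
    cofreeF k g ⟶ RLieMod.homFrom (adjointRestrict k g) ⋙ symF k g where
  app N := ⟨LinearMap.snd k N.carrier (g →ₗ[k] N), fun _ _ => rfl, fun _ _ => rfl⟩
  naturality _ _ _ := rfl

theorem asymToCofree_comp_cofreeToSym (N : RLieMod k (LieQuot k g)) :
    (asymToCofree (k := k) (g := g)).app N ≫ cofreeToSym.app N = 0 := rfl

/-- The left action vanishes on pairs `(n, 0)`, and on the `Hom` component it is minus the right
action. So the summand `N` is an antisymmetric submodule with symmetric quotient. -/
theorem shortExact_asymToCofree_cofreeToSym (N : RLieMod k (LieQuot k g)) :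
    (ShortComplex.mk _ _ (asymToCofree_comp_cofreeToSym N)).ShortExact := by
  refine (shortExact_iff _).2 ⟨fun (n n' : N) h => (Prod.ext_iff.1 h).1,
    fun (p : N.carrier × (g →ₗ[k] N)) => ⟨fun h => ⟨p.1, Prod.ext rfl h.symm⟩, ?_⟩,
    fun (f : g →ₗ[k] N) => ⟨((0, f) : N.carrier × (g →ₗ[k] N)), rfl⟩⟩
  rintro ⟨t, rfl⟩
  rfl

/-- The unit at `N^a` is `n ↦ (n, x ↦ x n)`, and there `x n = 0`. -/
theorem asymToCofree_app (N : RLieMod k (LieQuot k g)) : asymToCofree.app N =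
    (cofreeAdj k g).unit.app ((asymF k g).obj N) ≫
      (cofreeF k g).map ((asymRestrictIso k g).inv.app N) := rfl

end LeibMod

/-! ### Precomposition and biproducts of functors -/

section BiproductFunctors

variable {k : Type u} [Field k] {J J' : Type*} [Category* J] [Category* J']

attribute [local instance] preservesBinaryBiproducts_of_preservesBiproducts in
-- Precomposition with `F` is an additive functor between functor categories, hence preserves
-- biproducts.
theorem nonempty_comp_biprod_iso (F : J' ⥤ J) (A B : J ⥤ ModuleCat.{u} k) :
    Nonempty (F ⋙ (A ⊞ B) ≅ (F ⋙ A) ⊞ (F ⋙ B)) := by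
  have : ((Functor.whiskeringLeft J' J (ModuleCat.{u} k)).obj F).Additive := { map_add := rfl }
  exact ⟨((Functor.whiskeringLeft J' J (ModuleCat.{u} k)).obj F).mapBiprod A B⟩

theorem nonempty_iso_biprod_trans {E A B B' : J ⥤ ModuleCat.{u} k} (h : Nonempty (E ≅ A ⊞ B))
    (h' : Nonempty (B ≅ B')) : Nonempty (E ≅ A ⊞ B') :=
  ⟨h.some ≪≫ biprod.mapIso (Iso.refl A) h'.some⟩

end BiproductFunctors

/-! ### The six decompositions -/

namespace LeibMod

variable (k : Type u) [Field k] (g : Type u) [NonUnitalNonAssocRing g] [Module k g]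
  [IsScalarTower k g g] [SMulCommClass k g g] [IsRightLeibniz g]

theorem nonempty_extFrom_triv_sym_iso (n : ℤ) :
    Nonempty (symF k g ⋙ extFrom k (triv k g) n ≅ lieCohomology k (LieQuot k g) n ⊞
      (symF k g ⋙ extFrom k ((asymF k g).obj (adjointRestrict k g)) (n - 1))) := by
  have h := nonempty_extFrom_iso_biprod_of_sub k shortExact_asymToFree_freeToSym
    (RLieMod.triv k (LieQuot k g)) (fun N n => bijective_app_comp_mapExactFunctor
      (freeAdj k g) (symRestrictIso k g) freeToSym freeToSym_app _ N n) n
  rw [symF_obj_triv] at h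
  refine nonempty_iso_biprod_trans h ?_
  -- The general splitting produces `(k ⊗ g^↓)^a`, which is replaced by `(g^↓)^a`.
  obtain ⟨e⟩ := nonempty_extFrom_iso k
    ((asymF k g).mapIso (RLieMod.tensorTrivIso (adjointRestrict k g))).symm (n - 1)
  exact ⟨Functor.isoWhiskerLeft (symF k g) e⟩

theorem nonempty_extTo_triv_sym_iso (n : ℤ) :
    Nonempty ((symF k g).op ⋙ extTo k (triv k g) n ≅
      (RLieMod.dual k (LieQuot k g) ⋙ lieCohomology k (LieQuot k g) n) ⊞
        ((RLieMod.tensorRight (adjointRestrict k g) ⋙ asymF k g).op ⋙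
          extTo k (triv k g) (n - 1))) := by
  have h := nonempty_extTo_iso_biprod_of_sub k shortExact_asymToFree_freeToSym
    (RLieMod.triv k (LieQuot k g)) (fun M n => bijective_app_comp_mapExactFunctor
      (freeAdj k g) (symRestrictIso k g) freeToSym freeToSym_app M _ n) n
  rw [symF_obj_triv] at h
  exact ⟨h.some ≪≫ biprod.mapIso (RLieMod.nonempty_extTo_triv_iso k _ n).some (Iso.refl _)⟩

/-- The case `M = k` of the splitting along `0 → N^a → G N → Hom(g^↓, N)^s → 0`. Here `k^a` is the
trivial module by definition. -/
theorem nonempty_extFrom_triv_asym_iso (n : ℤ) :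
    Nonempty (asymF k g ⋙ extFrom k (triv k g) n ≅ lieCohomology k (LieQuot k g) n ⊞
      (RLieMod.homFrom (adjointRestrict k g) ⋙ symF k g ⋙ extFrom k (triv k g) (n - 1))) :=
  nonempty_extFrom_iso_biprod_of_quotient k shortExact_asymToCofree_cofreeToSym
    (RLieMod.triv k (LieQuot k g)) (fun N n => bijective_mapExactFunctor_comp_app
      (cofreeAdj k g) (asymRestrictIso k g) asymToCofree asymToCofree_app _ N n) n

theorem nonempty_extTo_triv_asym_iso (n : ℤ) :
    Nonempty ((asymF k g).op ⋙ extTo k (triv k g) n ≅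
      (RLieMod.dual k (LieQuot k g) ⋙ lieCohomology k (LieQuot k g) n) ⊞
        ((asymF k g).op ⋙ extTo k ((symF k g).obj ((RLieMod.dual k (LieQuot k g)).obj
          (Opposite.op (adjointRestrict k g)))) (n - 1))) := by
  have h := nonempty_extTo_iso_biprod_of_quotient k shortExact_asymToCofree_cofreeToSym
    (RLieMod.triv k (LieQuot k g)) (fun M n => bijective_mapExactFunctor_comp_app
      (cofreeAdj k g) (asymRestrictIso k g) asymToCofree asymToCofree_app M _ n) n
  exact ⟨h.some ≪≫ biprod.mapIso (RLieMod.nonempty_extTo_triv_iso k _ n).some (Iso.refl _)⟩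

/-- The remainder `Ext^{n-1}((N ⊗ g^↓)^a, k)` is decomposed again by the antisymmetric case at `N ⊗
g^↓`. -/
theorem nonempty_extTo_triv_sym_iso_two_step (n : ℤ) :
    Nonempty ((symF k g).op ⋙ extTo k (triv k g) n ≅
      (RLieMod.dual k (LieQuot k g) ⋙ lieCohomology k (LieQuot k g) n) ⊞
        (((RLieMod.tensorRight (adjointRestrict k g)).op ⋙
            RLieMod.dual k (LieQuot k g) ⋙ lieCohomology k (LieQuot k g) (n - 1)) ⊞
          ((RLieMod.tensorRight (adjointRestrict k g) ⋙ asymF k g).op ⋙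
            extTo k ((symF k g).obj ((RLieMod.dual k (LieQuot k g)).obj
              (Opposite.op (adjointRestrict k g)))) (n - 2)))) := by
  refine nonempty_iso_biprod_trans (nonempty_extTo_triv_sym_iso k g n) ?_
  obtain ⟨e⟩ := nonempty_extTo_triv_asym_iso k g (n - 1)
  obtain ⟨e'⟩ := nonempty_comp_biprod_iso (RLieMod.tensorRight (adjointRestrict k g)).op
    (RLieMod.dual k (LieQuot k g) ⋙ lieCohomology k (LieQuot k g) (n - 1))
    ((asymF k g).op ⋙ extTo k ((symF k g).obj ((RLieMod.dual k (LieQuot k g)).obj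
      (Opposite.op (adjointRestrict k g)))) (n - 1 - 1))
  rw [show n - 2 = n - 1 - 1 by ring]
  exact ⟨Functor.isoWhiskerLeft (RLieMod.tensorRight (adjointRestrict k g)).op e ≪≫ e'⟩

/-- The remainder `Ext^{n-1}(k, Hom(g^↓, N)^s)` is decomposed again by the symmetric case at
`Hom(g^↓, N)`. -/
theorem nonempty_extFrom_triv_asym_iso_two_step (n : ℤ) :
    Nonempty (asymF k g ⋙ extFrom k (triv k g) n ≅
      lieCohomology k (LieQuot k g) n ⊞
        ((RLieMod.homFrom (adjointRestrict k g) ⋙ lieCohomology k (LieQuot k g) (n - 1)) ⊞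
          (RLieMod.homFrom (adjointRestrict k g) ⋙ symF k g ⋙
            extFrom k ((asymF k g).obj (adjointRestrict k g)) (n - 2)))) := by
  refine nonempty_iso_biprod_trans (nonempty_extFrom_triv_asym_iso k g n) ?_
  obtain ⟨e⟩ := nonempty_extFrom_triv_sym_iso k g (n - 1)
  obtain ⟨e'⟩ := nonempty_comp_biprod_iso (RLieMod.homFrom (adjointRestrict k g))
    (lieCohomology k (LieQuot k g) (n - 1))
    (symF k g ⋙ extFrom k ((asymF k g).obj (adjointRestrict k g)) (n - 1 - 1))
  rw [show n - 2 = n - 1 - 1 by ring]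
  exact ⟨Functor.isoWhiskerLeft (RLieMod.homFrom (adjointRestrict k g)) e ≪≫ e'⟩

end LeibMod

theorem corollary7p4 {k : Type u} [Field k] {g : Type u} [NonUnitalNonAssocRing g] [Module k g]
    [IsScalarTower k g g] [SMulCommClass k g g] [IsRightLeibniz g] (n : ℤ) :
    -- `Ext^n(k, N^s) ≅ H^n(g_Lie; N) ⊕ Ext^{n-1}((g^↓)^a, N^s)`
    Nonempty (LeibMod.symF k g ⋙ extFrom k (LeibMod.triv k g) n ≅
      lieCohomology k (LieQuot k g) n ⊞
        (LeibMod.symF k g ⋙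
          extFrom k ((LeibMod.asymF k g).obj (LeibMod.adjointRestrict k g)) (n - 1))) ∧
    -- `Ext^n(N^s, k) ≅ H^n(g_Lie; N^♯) ⊕ Ext^{n-1}((N ⊗ g^↓)^a, k)`
    Nonempty ((LeibMod.symF k g).op ⋙ extTo k (LeibMod.triv k g) n ≅
      (RLieMod.dual k (LieQuot k g) ⋙ lieCohomology k (LieQuot k g) n) ⊞
        ((RLieMod.tensorRight (LeibMod.adjointRestrict k g) ⋙ LeibMod.asymF k g).op ⋙
          extTo k (LeibMod.triv k g) (n - 1))) ∧
    -- `Ext^n(k, N^a) ≅ H^n(g_Lie; N) ⊕ Ext^{n-1}(k, Hom(g^↓, N)^s)`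
    Nonempty (LeibMod.asymF k g ⋙ extFrom k (LeibMod.triv k g) n ≅
      lieCohomology k (LieQuot k g) n ⊞
        (RLieMod.homFrom (LeibMod.adjointRestrict k g) ⋙ LeibMod.symF k g ⋙
          extFrom k (LeibMod.triv k g) (n - 1))) ∧
    -- `Ext^n(N^a, k) ≅ H^n(g_Lie; N^♯) ⊕ Ext^{n-1}(N^a, ((g^↓)^♯)^s)`
    Nonempty ((LeibMod.asymF k g).op ⋙ extTo k (LeibMod.triv k g) n ≅
      (RLieMod.dual k (LieQuot k g) ⋙ lieCohomology k (LieQuot k g) n) ⊞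
        ((LeibMod.asymF k g).op ⋙
          extTo k ((LeibMod.symF k g).obj ((RLieMod.dual k (LieQuot k g)).obj
            (Opposite.op (LeibMod.adjointRestrict k g)))) (n - 1))) ∧
    -- `Ext^n(N^s, k) ≅`
    -- `H^n(g_Lie; N^♯) ⊕ H^{n-1}(g_Lie; (N ⊗ g^↓)^♯) ⊕ Ext^{n-2}((N ⊗ g^↓)^a, ((g^↓)^♯)^s)`
    Nonempty ((LeibMod.symF k g).op ⋙ extTo k (LeibMod.triv k g) n ≅
      (RLieMod.dual k (LieQuot k g) ⋙ lieCohomology k (LieQuot k g) n) ⊞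
        (((RLieMod.tensorRight (LeibMod.adjointRestrict k g)).op ⋙
            RLieMod.dual k (LieQuot k g) ⋙ lieCohomology k (LieQuot k g) (n - 1)) ⊞
          ((RLieMod.tensorRight (LeibMod.adjointRestrict k g) ⋙ LeibMod.asymF k g).op ⋙
            extTo k ((LeibMod.symF k g).obj ((RLieMod.dual k (LieQuot k g)).obj
              (Opposite.op (LeibMod.adjointRestrict k g)))) (n - 2)))) ∧
    -- `Ext^n(k, N^a) ≅`
    -- `H^n(g_Lie; N) ⊕ H^{n-1}(g_Lie; Hom(g^↓, N)) ⊕ Ext^{n-2}((g^↓)^a, Hom(g^↓, N)^s)`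
    Nonempty (LeibMod.asymF k g ⋙ extFrom k (LeibMod.triv k g) n ≅
      lieCohomology k (LieQuot k g) n ⊞
        ((RLieMod.homFrom (LeibMod.adjointRestrict k g) ⋙
            lieCohomology k (LieQuot k g) (n - 1)) ⊞
          (RLieMod.homFrom (LeibMod.adjointRestrict k g) ⋙ LeibMod.symF k g ⋙
            extFrom k ((LeibMod.asymF k g).obj (LeibMod.adjointRestrict k g)) (n - 2)))) :=
  ⟨LeibMod.nonempty_extFrom_triv_sym_iso k g n, LeibMod.nonempty_extTo_triv_sym_iso k g n,
    LeibMod.nonempty_extFrom_triv_asym_iso k g n, LeibMod.nonempty_extTo_triv_asym_iso k g n,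
    LeibMod.nonempty_extTo_triv_sym_iso_two_step k g n,
    LeibMod.nonempty_extFrom_triv_asym_iso_two_step k g n⟩
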